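/- **Theorem 3.4.** Let $X$ be a locally finite simplicial complex of dimension $n$ in which every simplex $\sigma$ is contained in some $n$-simplex; let $m(\sigma)\ge 1$ be the number of $n$-simplices containing $\sigma$. Assume that the links of all simplices of dimension at most $n-2$ are connected. Let $\Gamma$ be a locally compact unimodular group acting on $X$ by simplicial automorphisms, properly in the sense that the stabilizers of vertices are compact and open, and let $|\cdot|$ denote Haar measure on $\Gamma$. *Cohomology.* Let $\Sigma(j)$ be the set of ordered $j$-simplices (tuples of $j+1$ distinct vertices spanning a simplex), and $\Sigma(j,\Gamma)\subset\Sigma(j)$ a set of representatives of the $\Gamma$-orbits. For a unitary representation $\rho$ of $\Gamma$ on a complex Hilbert space $H$, let $L^j(X,\rho)$ be the space of alternating maps $\phi:\Sigma(j)\to H$ with $\phi(g\sigma)=\rho(g)\phi(\sigma)$ for all $g\in\Gamma$, $\sigma\in\Sigma(j)$, and $$\sum_{\sigma\in\Sigma(j,\Gamma)}\frac{m(\sigma)}{(j+1)!\,|\Gamma_\sigma|}\,\|\phi(\sigma)\|^2<\infty ,$$ where $\Gamma_\sigma$ is the stabilizer of the ordered simplex $\sigma$. Let $d\phi(v_0,\dots,v_{j+1})=\sum_i(-1)^i\phi(v_0,\dots,\hat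 v_i,\dots,v_{j+1})$ and, for $j\ge1$, $L^2H^j(X,\rho)=\ker(d|_{L^j(X,\rho)})/\operatorname{im}(d|_{L^{j-1}(X,\rho)})$. *Eigenvalues.* Let $1\le k<n$. For a $(k-1)$-simplex $\tau$ let $X_\tau$ be its link, a finite complex of dimension $n-k$, and for a simplex $\eta$ of $X_\tau$ let $m_\tau(\eta)$ be the number of $(n-k)$-simplices of $X_\tau$ containing $\eta$. Let $\lambda_\tau$ be the smallest positive eigenvalue of the Laplacian $$(\Delta^+_\tau f)(u)=\sum_{v}\frac{m_\tau(\{u,v\})}{m_\tau(\{u\})}\,\bigl(f(u)-f(v)\bigr)$$ on real functions on the vertices of $X_\tau$, the sum being over the vertices $v$ of $X_\tau$ adjacent to $u$. For a $k$-simplex $\sigma$ put $$S_\sigma=\sum_{\tau}\Bigl(\lambda_\tau-\frac{k(n-k)}{k+1}\Bigr),$$ the sum being over the $k+1$ faces $\tau$ of $\sigma$ of dimension $k-1$. *Determinant polynomial.* For $k<l\le n$ and an ordered $l$-simplex $\gamma$, let $F$ and $F'$ be the sets of $k$-faces and $(k+1)$-faces of $\gamma$, ordered as in $\gamma$. For $\nu=(v_0,\dots,v_{k+1})\in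 F'$ and $\sigma\in F$ put $[\nu:\sigma]=(-1)^i$ if $\sigma=(v_0,\dots,\hat v_i,\dots,v_{k+1})$, and $[\nu:\sigma]=0$ if $\sigma$ is not a face of $\nu$. Let $$M_k^l=\begin{pmatrix}\operatorname{diag}(x_\sigma)_{\sigma\in F}&B\\ B^{T}&0\end{pmatrix},\qquad B=([\nu:\sigma])_{\sigma\in F,\ \nu\in F'},$$ and $p_k^l\bigl((x_\sigma)_{\sigma\in F}\bigr)=\det M_k^l$. *Claim.* Let $1\le k<n$. Suppose that for some $l$ with $k<l\le n$ and some $\varepsilon>0$ the following holds for every $\gamma\in\Sigma(l,\Gamma)$: every real $\lambda$ at which $p_k^l$ vanishes when each $x_\sigma$ is replaced by $\lambda-S_\sigma$ satisfies $\lambda\ge\varepsilon$. Then $L^2H^k(X,\rho)=0$ for every unitary representation $\rho$ of $\Gamma$. -/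

import Mathlib

open scoped Pointwise

namespace LinkCriterion

/-! ## Ordered simplices -/

section Simplices

variable {V : Type*}

/-- An ordered `k`-simplex of a simplicial complex: a `(k+1)`-tuple of distinct vertices which
span a face. -/
def OrdSimplex (K : PreAbstractSimplicialComplex V) (k : ℕ) : Type _ :=
  {σ : Fin (k + 1) ↪ V // Finset.univ.map σ ∈ K.faces}

namespace OrdSimplex

variable {K : PreAbstractSimplicialComplex V} {k l : ℕ}

/-- The set of vertices of an ordered simplex. -/
def vertices (σ : OrdSimplex K k) : Finset V := Finset.univ.map σ.1

/-- The ordered face `(γ (f 0), …, γ (f k))` of `γ` selected by a strictly monotone `f`. Thus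
`σ ⊏ γ` exactly when `σ = γ.sub f` for some `f`. -/
def sub (γ : OrdSimplex K l) (f : Fin (k + 1) ↪o Fin (l + 1)) : OrdSimplex K k :=
  ⟨f.toEmbedding.trans γ.1, (K.isRelLowerSet_faces γ.2).2
    (by intro v hv; simp only [Finset.mem_map] at hv ⊢; obtain ⟨i, -, rfl⟩ := hv
        exact ⟨f i, Finset.mem_univ _, rfl⟩)
    ⟨γ.1 (f 0), Finset.mem_map.2 ⟨0, Finset.mem_univ _, rfl⟩⟩⟩

/-- The `i`-th face, obtained by omitting the `i`-th vertex. -/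
def face (σ : OrdSimplex K (k + 1)) (i : Fin (k + 2)) : OrdSimplex K k :=
  σ.sub (Fin.succAboveOrderEmb i)

/-- The same simplex with its vertices reordered. -/
def perm (σ : OrdSimplex K k) (π : Equiv.Perm (Fin (k + 1))) : OrdSimplex K k :=
  ⟨π.toEmbedding.trans σ.1, by
    have h : Finset.univ.map (π.toEmbedding.trans σ.1) = Finset.univ.map σ.1 := by
      rw [← Finset.map_map, Finset.map_univ_equiv]
    rw [h]; exact σ.2⟩

end OrdSimplex

/-! ## Geometric conditions on a complex -/

/-- Every vertex lies in only finitely many faces. -/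
def IsLocallyFinite (K : PreAbstractSimplicialComplex V) : Prop :=
  ∀ v : V, {s ∈ K.faces | v ∈ s}.Finite

/-- The complex has dimension exactly `n`. -/
def HasDim (K : PreAbstractSimplicialComplex V) (n : ℕ) : Prop :=
  (∃ s ∈ K.faces, s.card = n + 1) ∧ ∀ s ∈ K.faces, s.card ≤ n + 1

/-- `m(s)`: the number of (unordered) `n`-simplices containing `s`. -/
noncomputable def topCount (K : PreAbstractSimplicialComplex V) (n : ℕ) (s : Finset V) : ℕ :=
  {t ∈ K.faces | t.card = n + 1 ∧ s ⊆ t}.ncard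

/-- The `1`-skeleton of a complex, as a graph on its vertices. -/
def skeletonGraph [DecidableEq V] (K : PreAbstractSimplicialComplex V) :
    SimpleGraph {v : V // {v} ∈ K.faces} where
  Adj u v := u ≠ v ∧ ({u.1, v.1} : Finset V) ∈ K.faces
  symm := ⟨fun u v h => ⟨h.1.symm, by rw [Finset.pair_comm]; exact h.2⟩⟩
  loopless := ⟨fun _ h => h.1 rfl⟩

/-- The link of `τ`: the simplices disjoint from `τ` which span a simplex together with `τ`. -/
def link [DecidableEq V] (K : PreAbstractSimplicialComplex V) (τ : Finset V) :
    PreAbstractSimplicialComplex V where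
  faces := {s | s.Nonempty ∧ Disjoint s τ ∧ s ∪ τ ∈ K.faces}
  isRelLowerSet_faces := by
    rintro s ⟨hs, hd, hu⟩
    refine ⟨hs, fun t hts ht => ⟨ht, hd.mono_left hts, ?_⟩⟩
    exact (K.isRelLowerSet_faces hu).2 (Finset.union_subset_union_left hts)
      (ht.mono Finset.subset_union_left)

/-- All links of positive dimension of an `n`-dimensional complex are connected. The link of a
simplex with `c` vertices has dimension `n - c`. -/
def HasConnectedLinks [DecidableEq V] (K : PreAbstractSimplicialComplex V) (n : ℕ) : Prop :=
  ∀ τ ∈ K.faces, τ.card < n → (skeletonGraph (link K τ)).Connected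

/-! ## Differential, codifferential, Laplacian of links -/

section Differential

variable (K : PreAbstractSimplicialComplex V)

/-- The simplicial differential `dφ(σ) = ∑ i, (-1)^i φ(σ_i)` on functions on ordered simplices. -/
def diff (𝕜 : Type*) [Ring 𝕜] (E : Type*) [AddCommGroup E] [Module 𝕜 E] (k : ℕ) :
    (OrdSimplex K k → E) →ₗ[𝕜] (OrdSimplex K (k + 1) → E) where
  toFun φ σ := ∑ i : Fin (k + 2), (-1 : ℤ) ^ (i : ℕ) • φ (σ.face i)
  map_add' φ ψ := by
    funext σ
    simp [Finset.sum_add_distrib]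
  map_smul' c φ := by
    funext σ
    simp only [Pi.smul_apply, RingHom.id_apply, Finset.smul_sum]
    exact Finset.sum_congr rfl fun i _ => (smul_comm _ _ _)

/-- The codifferential of an `n`-dimensional complex,
`δφ(τ) = ∑ (m(vτ)/m(τ)) φ(vτ)` over the vertices `v` for which `vτ` is a simplex; the ordered
simplices `vτ` are those whose face omitting the first vertex is `τ`. -/
noncomputable def codiff (n k : ℕ) (φ : OrdSimplex K (k + 1) → ℝ) (τ : OrdSimplex K k) : ℝ :=
  ∑ᶠ σ : {σ : OrdSimplex K (k + 1) // σ.face 0 = τ},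
    (topCount K n σ.1.vertices : ℝ) / (topCount K n τ.vertices : ℝ) * φ σ.1

/-- The Laplacian `Δ⁺ = δ d` on real functions on the vertices of an `n`-dimensional complex. -/
noncomputable def upLaplacian (n : ℕ) (φ : OrdSimplex K 0 → ℝ) : OrdSimplex K 0 → ℝ :=
  codiff K n 0 (diff K ℝ ℝ 0 φ)

/-- The smallest positive eigenvalue of `Δ⁺` on real functions on the vertices. -/
noncomputable def smallestPosEigenvalue (n : ℕ) : ℝ :=
  sInf {x : ℝ | 0 < x ∧ ∃ φ : OrdSimplex K 0 → ℝ, φ ≠ 0 ∧ upLaplacian K n φ = x • φ}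

end Differential

/-- `λ_τ - k(n-k)/(k+1)` for a `(k-1)`-simplex `τ`, where `λ_τ` is the smallest positive eigenvalue
of the Laplacian of the link of `τ`, which has dimension `n - k`. -/
noncomputable def shiftedEigenvalue [DecidableEq V] (X : PreAbstractSimplicialComplex V)
    (n k : ℕ) (τ : Finset V) : ℝ :=
  smallestPosEigenvalue (link X τ) (n - k) - (k : ℝ) * ((n : ℝ) - k) / ((k : ℝ) + 1)

/-- `S_σ`: the sum of the shifted eigenvalues over the `(k-1)`-dimensional faces of `σ`. -/
noncomputable def faceSum [DecidableEq V] (X : PreAbstractSimplicialComplex V) (n : ℕ) {k : ℕ}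
    (σ : OrdSimplex X k) : ℝ :=
  ∑ τ ∈ σ.vertices.powersetCard k, shiftedEigenvalue X n k τ

end Simplices

/-! ## The determinant polynomial -/

/-- The incidence number `[ν : σ]` of the `k`-face `σ` and the `(k+1)`-face `ν` of an ordered
`l`-simplex, faces being given by the strictly monotone selections of their vertices: it is
`(-1)^i` if `σ` is `ν` with its `i`-th vertex omitted, and `0` if there is no such `i`. -/
def incidence {k l : ℕ} (σ : Fin (k + 1) ↪o Fin (l + 1)) (ν : Fin (k + 2) ↪o Fin (l + 1)) : ℤ :=
  ∑ i : Fin (k + 2), if (Fin.succAboveOrderEmb i).trans ν = σ then (-1) ^ (i : ℕ) else 0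

/-- The matrix `M_k^l`, indexed by the `k`-faces and the `(k+1)`-faces of an `l`-simplex: variables
`x_σ` on the diagonal of the first block, incidence numbers in the off-diagonal blocks, and a zero
block. -/
noncomputable def incidenceMatrix (k l : ℕ) :
    Matrix ((Fin (k + 1) ↪o Fin (l + 1)) ⊕ (Fin (k + 2) ↪o Fin (l + 1)))
      ((Fin (k + 1) ↪o Fin (l + 1)) ⊕ (Fin (k + 2) ↪o Fin (l + 1)))
      (MvPolynomial (Fin (k + 1) ↪o Fin (l + 1)) ℝ) :=
  Matrix.fromBlocks
    (Matrix.diagonal fun σ => MvPolynomial.X σ)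
    (Matrix.of fun σ ν => (incidence σ ν : MvPolynomial (Fin (k + 1) ↪o Fin (l + 1)) ℝ))
    (Matrix.of fun ν σ => (incidence σ ν : MvPolynomial (Fin (k + 1) ↪o Fin (l + 1)) ℝ))
    0

/-- The polynomial `p_k^l = det M_k^l`. -/
noncomputable def detPoly (k l : ℕ) : MvPolynomial (Fin (k + 1) ↪o Fin (l + 1)) ℝ :=
  (incidenceMatrix k l).det

/-! ## Group actions -/

section Action

variable {V : Type*} [DecidableEq V] (Γ : Type*) [Group Γ] [MulAction Γ V]

/-- `Γ` acts on the complex `X` by simplicial automorphisms. -/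
class IsSimplicialAction (X : PreAbstractSimplicialComplex V) : Prop where
  smul_mem : ∀ (g : Γ), ∀ s ∈ X.faces, g • s ∈ X.faces

/-- The action of `Γ` on ordered simplices, vertex by vertex. -/
instance OrdSimplex.instMulAction (X : PreAbstractSimplicialComplex V) [IsSimplicialAction Γ X]
    (k : ℕ) : MulAction Γ (OrdSimplex X k) where
  smul g σ := ⟨g • σ.1, by
    have h : Finset.univ.map (g • σ.1) = g • Finset.univ.map σ.1 := by
      ext v
      simp [Finset.mem_smul_finset]
    rw [h]; exact IsSimplicialAction.smul_mem g _ σ.2⟩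
  one_smul σ := Subtype.ext (one_smul Γ σ.1)
  mul_smul g h σ := Subtype.ext (mul_smul g h σ.1)

/-- The action on the vertices of `X` is proper and smooth: the stabilizers of vertices are compact
and open. -/
def IsProperAction [TopologicalSpace Γ] (X : PreAbstractSimplicialComplex V) : Prop :=
  ∀ v : V, {v} ∈ X.faces → IsCompact (MulAction.stabilizer Γ v : Set Γ) ∧
    IsOpen (MulAction.stabilizer Γ v : Set Γ)

/-- `R` contains exactly one element of every `Γ`-orbit. -/
def IsOrbitTransversal {A : Type*} [MulAction Γ A] (R : Set A) : Prop :=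
  ∀ a : A, ∃! r : A, r ∈ R ∧ r ∈ MulAction.orbit Γ a

end Action

/-! ## Twisted cochains and `L²`-cohomology -/

section Cochains

variable {V : Type*} [DecidableEq V] {Γ : Type*} [Group Γ] [MulAction Γ V]
  (X : PreAbstractSimplicialComplex V) [IsSimplicialAction Γ X]
  {H : Type*} [NormedAddCommGroup H] [InnerProductSpace ℂ H] [CompleteSpace H]
  (ρ : Γ →* unitary (H →L[ℂ] H))

/-- `C^k(X,ρ)`: alternating functions on ordered `k`-simplices, twisted by `ρ`. -/
def twistedCochains (k : ℕ) : Submodule ℂ (OrdSimplex X k → H) where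
  carrier := {φ | (∀ (σ : OrdSimplex X k) (π : Equiv.Perm (Fin (k + 1))),
      φ (σ.perm π) = (Equiv.Perm.sign π : ℤ) • φ σ) ∧
    ∀ (g : Γ) (σ : OrdSimplex X k), φ (g • σ) = (ρ g : H →L[ℂ] H) (φ σ)}
  zero_mem' := by constructor <;> simp
  add_mem' := by
    rintro φ ψ ⟨h1, h2⟩ ⟨h3, h4⟩
    refine ⟨fun σ π => ?_, fun g σ => ?_⟩
    · simp only [Pi.add_apply, h1 σ π, h3 σ π, smul_add]
    · simp only [Pi.add_apply, h2 g σ, h4 g σ, map_add]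
  smul_mem' := by
    rintro c φ ⟨h1, h2⟩
    refine ⟨fun σ π => ?_, fun g σ => ?_⟩
    · simp only [Pi.smul_apply, h1 σ π]
      exact smul_comm _ _ _
    · simp only [Pi.smul_apply, h2 g σ, map_smul]

variable [MeasurableSpace Γ] (μ : MeasureTheory.Measure Γ) (n : ℕ)

/-- The weight `m(σ) / ((k+1)! |Γ_σ|)`, where `Γ_σ` is the stabilizer of the ordered simplex `σ` and
`|Γ_σ|` is its measure. -/
noncomputable def weight {k : ℕ} (σ : OrdSimplex X k) : ℝ :=
  (topCount X n σ.vertices : ℝ) /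
    ((Nat.factorial (k + 1) : ℝ) * μ.real (MulAction.stabilizer Γ σ : Set Γ))

theorem weight_nonneg {k : ℕ} (σ : OrdSimplex X k) : 0 ≤ weight X μ n σ := by
  unfold weight
  positivity

/-- `L^k(X,ρ)`: the twisted cochains which are square integrable modulo `Γ`, the sum being over the
set `R` of representatives of the `Γ`-orbits of ordered `k`-simplices. -/
def l2Cochains (k : ℕ) (R : Set (OrdSimplex X k)) : Submodule ℂ (OrdSimplex X k → H) where
  carrier := {φ | φ ∈ twistedCochains X ρ k ∧
    Summable fun σ : R => weight X μ n σ.1 * ‖φ σ.1‖ ^ 2}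
  zero_mem' := ⟨Submodule.zero_mem _, by simp⟩
  add_mem' := by
    rintro φ ψ ⟨h1, h2⟩ ⟨h3, h4⟩
    refine ⟨Submodule.add_mem _ h1 h3, ?_⟩
    refine Summable.of_nonneg_of_le (fun σ => ?_) (fun σ => ?_) ((h2.add h4).mul_left 2)
    · exact mul_nonneg (weight_nonneg X μ n σ.1) (sq_nonneg _)
    · have h5 := weight_nonneg X μ n σ.1
      have h6 : ‖φ σ.1 + ψ σ.1‖ ^ 2 ≤ 2 * (‖φ σ.1‖ ^ 2 + ‖ψ σ.1‖ ^ 2) := by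
        have h7 := norm_add_le (φ σ.1) (ψ σ.1)
        have h8 := norm_nonneg (φ σ.1 + ψ σ.1)
        nlinarith [sq_nonneg (‖φ σ.1‖ - ‖ψ σ.1‖)]
      have h9 := mul_le_mul_of_nonneg_left h6 h5
      simp only [Pi.add_apply]
      linarith
  smul_mem' := by
    rintro c φ ⟨h1, h2⟩
    refine ⟨Submodule.smul_mem _ c h1, ?_⟩
    refine (h2.mul_left (‖c‖ ^ 2)).congr fun σ => ?_
    simp only [Pi.smul_apply, norm_smul]
    ring

/-- `ker (d | L^k(X,ρ))`. -/
def l2Cocycles (k : ℕ) (R : Set (OrdSimplex X k)) : Submodule ℂ (OrdSimplex X k → H) :=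
  l2Cochains X ρ μ n k R ⊓ LinearMap.ker (diff X ℂ H k)

/-- `im (d | L^{k-1}(X,ρ))`, which is zero for `k = 0`. -/
def l2Coboundaries (R : ∀ j, Set (OrdSimplex X j)) :
    ∀ k : ℕ, Submodule ℂ (OrdSimplex X k → H)
  | 0 => ⊥
  | k + 1 => (l2Cochains X ρ μ n k (R k)).map (diff X ℂ H k)

/-- `L²H^k(X,ρ) = ker (d | L^k(X,ρ)) / im (d | L^{k-1}(X,ρ))` (not reduced: the image is not
closed up). -/
abbrev L2Cohomology (R : ∀ j, Set (OrdSimplex X j)) (k : ℕ) : Type _ :=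
  (l2Cocycles X ρ μ n k (R k)) ⧸
    (l2Coboundaries X ρ μ n R k).submoduleOf (l2Cocycles X ρ μ n k (R k))

end Cochains

end LinkCriterion

set_option linter.unusedSectionVars false

open MeasureTheory

/-! Write `k = j + 1` and give cochains the squared norm `∑ m(σ) ‖φ(σ)‖² / |Γ_σ|` over orbit
representatives; the factor `1 / (k+1)!` is constant and is dropped. Vanishing of the unreduced
cohomology means that `d`, from square integrable `(k-1)`-cochains to square integrable
`k`-cocycles, is onto. Both are Hilbert spaces, so it suffices that the adjoint of this map is
bounded below (`surjective_of_adjoint_bounded_below`). Up to the factor `k + 1` the adjoint is the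
codifferential `δφ(τ) = ∑ (m(vτ)/m(τ)) φ(vτ)` restricted to cocycles (`hasOrbitSum_inner_diff`).
Thus everything reduces to an estimate `ε ‖φ‖² ≤ const · ‖δφ‖²` for cocycles
(`le_codiff_of_detPoly`).

The estimate follows Garland's method. On the link of a `(k-1)`-simplex `τ` consider the function `v
↦ φ(vτ)`. Its weighted mean is a multiple of `δφ(τ)`, so the Poincaré inequality on the connected
link bounds its energy below by `λ_τ` times its squared norm, minus a multiple of `‖δφ(τ)‖²`. Summed
over all `τ`, the energy of a cocycle is exactly `k(n-k)/(k+1) · ‖φ‖²` (`hasOrbitSum_energy`), which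
explains the shift in `S_σ`. The result, `garland_estimate`, bounds a sum of shifted eigenvalues
against `‖φ(σ)‖²` by a multiple of `‖δφ‖²`, because the `λ_τ` are at most `2n`. By symmetry among
the `k + 1` faces of `σ`, the bounded sum is `1/(k+1)` times `∑ m(σ) S_σ ‖φ(σ)‖²`.

The numbers `S_σ` need not be positive one by one. The sum is therefore redistributed over the
`l`-simplices `γ` (`exists_reindex_const`). The restriction of a cocycle to `γ` is annihilated by
the transposed incidence matrix, and the roots of the bordered determinant include the eigenvalues
of `diag(S_σ)` compressed to that kernel. The hypothesis on `p_k^l` thus says that the compressed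
form is at least `ε` (`le_form_of_det`).

All rearrangements of sums over orbits rest on one principle, `HasOrbitSum.fiberSum`: for an
equivariant map with finite fibres, a sum weighted by `1/|Γ_a|` may be computed by first summing
over the fibres. -/

namespace LinkCriterion

/-! ## Sums over orbits weighted by the measure of stabilizers -/

section OrbitSums

variable {Γ : Type*} [Group Γ] [TopologicalSpace Γ] [IsTopologicalGroup Γ]
  [MeasurableSpace Γ] [BorelSpace Γ]
  (μ : Measure Γ) [μ.IsHaarMeasure]
  {A B : Type*} [MulAction Γ A] [MulAction Γ B]

/-- The measure of the stabilizer of a point. -/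
noncomputable def stabVol (a : A) : ℝ := μ.real (MulAction.stabilizer Γ a : Set Γ)

variable (Γ A) in
/-- All point stabilizers are compact and open. -/
def HasCompactOpenStabilizers : Prop :=
  ∀ a : A, IsCompact (MulAction.stabilizer Γ a : Set Γ) ∧
    IsOpen (MulAction.stabilizer Γ a : Set Γ)

/-- A real function which is constant on orbits. -/
def IsOrbitInvariant (Γ : Type*) [Group Γ] {A E : Type*} [MulAction Γ A] (f : A → E) : Prop :=
  ∀ (g : Γ) (a : A), f (g • a) = f a

/-- The sum of `f` over a set `R` of orbit representatives, weighted by the inverse measures of the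
stabilizers, converges to `s`. -/
def HasOrbitSum (R : Set A) (f : A → ℝ) (s : ℝ) : Prop :=
  HasSum (fun r : R => f r / stabVol μ r.1) s

/-- The weighted sum of `f` over a set `R` of orbit representatives converges. -/
def OrbitSummable (R : Set A) (f : A → ℝ) : Prop :=
  Summable (fun r : R => f r / stabVol μ r.1)

theorem stabVol_pos (hA : HasCompactOpenStabilizers Γ A) (a : A) : 0 < stabVol μ a := by
  have h1 := (hA a).2.measure_pos μ ⟨1, (MulAction.stabilizer Γ a).one_mem⟩
  exact ENNReal.toReal_pos h1.ne' (hA a).1.measure_lt_top.ne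

/-- The set is the left coset `h Γ_a`, so left invariance gives it the measure of `Γ_a`. -/
theorem measureReal_setOf_smul_eq (a : A) (h : Γ) :
    μ.real {g : Γ | g • a = h • a} = stabVol μ a := by
  have : {g : Γ | g • a = h • a} = (fun g => h⁻¹ * g) ⁻¹' (MulAction.stabilizer Γ a : Set Γ) := by
    ext g
    simp [MulAction.mem_stabilizer_iff, mul_smul, inv_smul_eq_iff]
  rw [this, stabVol, measureReal_def, measureReal_def, measure_preimage_mul]

theorem measurableSet_setOf_smul_eq (hA : HasCompactOpenStabilizers Γ A) (a x : A) :
    MeasurableSet {g : Γ | g • a = x} := by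
  by_cases hx : ∃ h : Γ, h • a = x
  · obtain ⟨h, rfl⟩ := hx
    have : {g : Γ | g • a = h • a} =
        (fun g => h⁻¹ * g) ⁻¹' (MulAction.stabilizer Γ a : Set Γ) := by
      ext g
      simp [MulAction.mem_stabilizer_iff, mul_smul, inv_smul_eq_iff]
    rw [this]
    exact ((hA a).2.preimage (continuous_const_mul _)).measurableSet
  · have : {g : Γ | g • a = x} = ∅ := by
      ext g
      simp only [Set.mem_ofPred_eq, Set.mem_empty_iff_false, iff_false]
      exact fun h => hx ⟨g, h⟩
    rw [this]
    exact MeasurableSet.empty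

/-- Stabilizers in one orbit are conjugate, and conjugation preserves a measure that is invariant on
both sides. This is where unimodularity enters. -/
theorem stabVol_smul [μ.IsMulRightInvariant] (g : Γ) (a : A) :
    stabVol μ (g • a) = stabVol μ a := by
  have : (MulAction.stabilizer Γ (g • a) : Set Γ) =
      (fun x => x * g) ⁻¹' ((fun x => g⁻¹ * x) ⁻¹' (MulAction.stabilizer Γ a : Set Γ)) := by
    ext x
    simp [MulAction.mem_stabilizer_iff, mul_smul, inv_smul_eq_iff]
  rw [stabVol, this, measureReal_def, measure_preimage_mul_right, measure_preimage_mul]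
  rfl

open Classical in
/-- The stabilizer of `p a` is partitioned into cosets of the stabilizer of `a`, which correspond to
the points of the orbit of `a` in the fibre of `p`. -/
theorem card_mul_stabVol (hA : HasCompactOpenStabilizers Γ A)
    (p : A → B) (hp : ∀ (g : Γ) a, p (g • a) = g • p a) (a : A)
    (S : Finset A) (hS : ∀ x, x ∈ S ↔ p x = p a) :
    ((S.filter fun x => x ∈ MulAction.orbit Γ a).card : ℝ) * stabVol μ a = stabVol μ (p a) := by
  have h1 : (MulAction.stabilizer Γ (p a) : Set Γ) =
      ⋃ x ∈ S.filter (fun x => x ∈ MulAction.orbit Γ a), {g : Γ | g • a = x} := by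
    ext g
    simp [MulAction.mem_stabilizer_iff, hS, hp]
  have h2 : ∀ x ∈ S.filter (fun x => x ∈ MulAction.orbit Γ a),
      μ.real {g : Γ | g • a = x} = stabVol μ a := by
    intro x hx
    obtain ⟨h, rfl⟩ := (Finset.mem_filter.1 hx).2
    exact measureReal_setOf_smul_eq μ a h
  have h3 : ∀ x ∈ S.filter (fun x => x ∈ MulAction.orbit Γ a),
      μ {g : Γ | g • a = x} ≠ ⊤ := by
    intro x hx h4
    have h5 := h2 x hx
    rw [measureReal_def, h4] at h5
    exact (stabVol_pos μ hA a).ne (by simpa using h5)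
  rw [stabVol, stabVol, h1, measureReal_biUnion_finset (fun x _ y _ hxy => ?_)
    (fun x _ => measurableSet_setOf_smul_eq hA a x) h3, Finset.sum_congr rfl h2,
    Finset.sum_const, nsmul_eq_mul, stabVol]
  rw [Function.onFun, Set.disjoint_left]
  intro g hg hg'
  exact hxy (hg.symm.trans hg')

variable {RA : Set A} {RB : Set B}

open Classical in
/-- The part of a weighted orbit sum lying over a single orbit. -/
theorem exists_finset_hasSum [μ.IsMulRightInvariant] (hA : HasCompactOpenStabilizers Γ A)
    (hB : HasCompactOpenStabilizers Γ B)
    (hRA : IsOrbitTransversal Γ RA)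
    (p : A → B) (hp : ∀ (g : Γ) a, p (g • a) = g • p a) (b : B)
    (S : Finset A) (hS : ∀ x, x ∈ S ↔ p x = b) :
    ∃ T : Finset RA, (∀ a : RA, a ∈ T ↔ p a ∈ MulAction.orbit Γ b) ∧
      ∀ f : A → ℝ, IsOrbitInvariant Γ f →
        ∑ a ∈ T, f a / stabVol μ a.1 = (∑ x ∈ S, f x) / stabVol μ b := by
  choose r hr hr' using fun a => (hRA a)
  have hrep : ∀ x (a : A), a ∈ RA → (r x = a ↔ x ∈ MulAction.orbit Γ a) := by
    intro x a ha
    constructor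
    · rintro rfl
      exact (MulAction.orbit_eq_iff.2 (hr x).2) ▸ MulAction.mem_orbit_self x
    · intro h
      refine (hr' x a ⟨ha, ?_⟩).symm
      exact (MulAction.orbit_eq_iff.2 h) ▸ MulAction.mem_orbit_self a
  refine ⟨S.image fun x => (⟨r x, (hr x).1⟩ : RA), fun a => ?_, fun f hf => ?_⟩
  · rw [Finset.mem_image]
    constructor
    · rintro ⟨x, hx, rfl⟩
      obtain ⟨g, hg⟩ := (hr x).2
      refine ⟨g, ?_⟩
      simp only at hg ⊢
      rw [← hg, hp, (hS x).1 hx]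
    · rintro ⟨g, hg⟩
      refine ⟨g⁻¹ • a.1, ?_, ?_⟩
      · rw [hS, hp, ← hg]
        simp
      · apply Subtype.ext
        simp only
        rw [hrep _ _ a.2]
        exact ⟨g⁻¹, rfl⟩
  -- The points of the fibre are grouped by orbit. An orbit with representative `a` contributes `c ·
  -- f a / |Γ_b|`, where `c` is the number of its points in the fibre; since `c |Γ_a| = |Γ_b|`, this
  -- is `f a / |Γ_a|`.
  · rw [← Finset.sum_fiberwise_of_maps_to
      (g := fun x => (⟨r x, (hr x).1⟩ : RA)) (fun x hx => Finset.mem_image_of_mem _ hx),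
      Finset.sum_div]
    refine Finset.sum_congr rfl fun a ha => ?_
    have h1 : S.filter (fun x => (⟨r x, (hr x).1⟩ : RA) = a) =
        S.filter fun x => x ∈ MulAction.orbit Γ a.1 := by
      ext x
      simp only [Finset.mem_filter, and_congr_right_iff]
      intro _
      rw [← hrep x a.1 a.2, Subtype.ext_iff]
    have h2 : ∀ x ∈ S.filter (fun x => x ∈ MulAction.orbit Γ a.1), f x = f a := by
      intro x hx
      obtain ⟨g, rfl⟩ := (Finset.mem_filter.1 hx).2
      exact hf g a
    rw [h1, Finset.sum_congr rfl h2, Finset.sum_const, nsmul_eq_mul]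
    obtain ⟨x, hx, rfl⟩ := Finset.mem_image.1 ha
    have h3 : stabVol μ (r x) = stabVol μ x := by
      obtain ⟨g, hg⟩ := (hr x).2
      rw [← hg]
      exact stabVol_smul μ g x
    have h4 := card_mul_stabVol μ hA p hp x S (fun y => by rw [hS, (hS x).1 hx])
    have h5 : MulAction.orbit Γ (r x) = MulAction.orbit Γ x := MulAction.orbit_eq_iff.2 (hr x).2
    rw [(hS x).1 hx] at h4
    have h6 := stabVol_pos μ hA x
    have h7 := stabVol_pos μ hB b
    simp only [h3, h5]
    rw [← h4] at h7 ⊢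
    rw [div_eq_div_iff h6.ne' h7.ne']
    ring

variable [μ.IsMulRightInvariant] (hA : HasCompactOpenStabilizers Γ A)
    (hB : HasCompactOpenStabilizers Γ B)
    (hRA : IsOrbitTransversal Γ RA) (hRB : IsOrbitTransversal Γ RB)
    (p : A → B) (hp : ∀ (g : Γ) a, p (g • a) = g • p a)
    (S : B → Finset A) (hS : ∀ x b, x ∈ S b ↔ p x = b)

include hA hB hRA hRB hp hS in
-- The map `q` sends `a` to the representative of the orbit of `p a`. Its fibres are the finite sets
-- supplied by `exists_finset_hasSum`. Keeping `q` independent of `f` lets the same regrouping serve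
-- both for evaluating sums and for proving summability.
theorem exists_fiber_hasSum :
    ∃ q : RA → RB, ∀ f : A → ℝ, IsOrbitInvariant Γ f → ∀ b : RB,
      HasSum (fun a : {a : RA // q a = b} => f a.1 / stabVol μ a.1.1)
        ((∑ x ∈ S b, f x) / stabVol μ b.1) := by
  choose r hr hr' using fun b => (hRB b)
  refine ⟨fun a => ⟨r (p a), (hr (p a)).1⟩, fun f hf b => ?_⟩
  obtain ⟨T, hT, hsum⟩ := exists_finset_hasSum μ hA hB hRA p hp b.1 (S b) (fun x => hS x b)
  rw [← hsum f hf]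
  have hiff : ∀ a : RA, (⟨r (p a), (hr (p a)).1⟩ : RB) = b ↔ a ∈ T := by
    intro a
    rw [hT]
    constructor
    · rintro rfl
      change p a ∈ MulAction.orbit Γ (r (p a))
      rw [MulAction.orbit_eq_iff.2 (hr (p a)).2]
      exact MulAction.mem_orbit_self (p a)
    · intro h
      refine Subtype.ext (hr' (p a) b ⟨b.2, ?_⟩).symm
      exact (MulAction.orbit_eq_iff.2 h) ▸ MulAction.mem_orbit_self b.1
  have h1 := T.hasSum (fun a : RA => f a.1 / stabVol μ a.1)
  have h2 := (Equiv.hasSum_iff (f := fun a : {a : RA // a ∈ T} => f a.1.1 / stabVol μ a.1.1)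
    (Equiv.subtypeEquivRight hiff)).2 h1
  exact h2

include hA hB hRA hRB hp hS in
/-- Weighted orbit sums can be computed by first summing over the fibres of an equivariant map. -/
theorem HasOrbitSum.fiberSum {f : A → ℝ} (hf : IsOrbitInvariant Γ f) {s : ℝ}
    (h : HasOrbitSum μ RA f s) : HasOrbitSum μ RB (fun b => ∑ x ∈ S b, f x) s := by
  obtain ⟨q, hq⟩ := exists_fiber_hasSum μ hA hB hRA hRB p hp S hS
  exact ((Equiv.hasSum_iff (Equiv.sigmaFiberEquiv q)).2 h).sigma (hq f hf)

include hA hB hRA hRB hp hS in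
-- A converse to `HasOrbitSum.fiberSum` at the level of summability. Nonnegativity rules out
-- cancellation inside the fibres.
theorem OrbitSummable.of_fiberSum {f : A → ℝ} (hf : IsOrbitInvariant Γ f) (hf0 : ∀ a, 0 ≤ f a)
    (h : OrbitSummable μ RB (fun b => ∑ x ∈ S b, f x)) : OrbitSummable μ RA f := by
  obtain ⟨q, hq⟩ := exists_fiber_hasSum μ hA hB hRA hRB p hp S hS
  unfold OrbitSummable
  rw [← Equiv.summable_iff (Equiv.sigmaFiberEquiv q), summable_sigma_of_nonneg]
  · refine ⟨fun b => (hq f hf b).summable, ?_⟩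
    refine h.congr fun b => ?_
    exact (hq f hf b).tsum_eq.symm
  · intro a
    exact div_nonneg (hf0 _) measureReal_nonneg

end OrbitSums

/-! ## Combinatorics of ordered simplices -/

namespace OrdSimplex

variable {V : Type*} {K : PreAbstractSimplicialComplex V} {j k l : ℕ}

theorem ext' {σ τ : OrdSimplex K k} (h : ∀ i, σ.1 i = τ.1 i) : σ = τ :=
  Subtype.ext (Function.Embedding.ext h)

/-- The ordered simplex whose vertices are selected from those of `γ` by an injective map. -/
def reindex (γ : OrdSimplex K l) (e : Fin (k + 1) ↪ Fin (l + 1)) : OrdSimplex K k :=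
  ⟨e.trans γ.1, (K.isRelLowerSet_faces γ.2).2
    (by intro v hv; simp only [Finset.mem_map] at hv ⊢; obtain ⟨i, -, rfl⟩ := hv
        exact ⟨e i, Finset.mem_univ _, rfl⟩)
    ⟨γ.1 (e 0), Finset.mem_map.2 ⟨0, Finset.mem_univ _, rfl⟩⟩⟩

@[simp] theorem reindex_apply (γ : OrdSimplex K l) (e : Fin (k + 1) ↪ Fin (l + 1)) (i) :
    (γ.reindex e).1 i = γ.1 (e i) := rfl

@[simp] theorem sub_apply (γ : OrdSimplex K l) (e : Fin (k + 1) ↪o Fin (l + 1)) (i) :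
    (γ.sub e).1 i = γ.1 (e i) := rfl

@[simp] theorem perm_apply (γ : OrdSimplex K l) (π : Equiv.Perm (Fin (l + 1))) (i) :
    (γ.perm π).1 i = γ.1 (π i) := rfl

@[simp] theorem face_apply (γ : OrdSimplex K (l + 1)) (i) (a) :
    (γ.face i).1 a = γ.1 (i.succAbove a) := rfl

theorem mem_vertices {σ : OrdSimplex K k} {v : V} : v ∈ σ.vertices ↔ ∃ i, σ.1 i = v := by
  simp [vertices]

theorem apply_mem_vertices (σ : OrdSimplex K k) (i) : σ.1 i ∈ σ.vertices :=
  mem_vertices.2 ⟨i, rfl⟩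

@[simp] theorem card_vertices (σ : OrdSimplex K k) : σ.vertices.card = k + 1 := by
  simp [vertices]

theorem vertices_mem (σ : OrdSimplex K k) : σ.vertices ∈ K.faces := σ.2

theorem vertices_nonempty (σ : OrdSimplex K k) : σ.vertices.Nonempty :=
  ⟨_, σ.apply_mem_vertices 0⟩

@[simp] theorem vertices_perm (σ : OrdSimplex K k) (π : Equiv.Perm (Fin (k + 1))) :
    (σ.perm π).vertices = σ.vertices := by
  ext v
  simp only [mem_vertices, perm_apply]
  exact ⟨fun ⟨i, hi⟩ => ⟨_, hi⟩, fun ⟨i, hi⟩ => ⟨π.symm i, by simpa using hi⟩⟩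

theorem vertices_face [DecidableEq V] (σ : OrdSimplex K (k + 1)) (i) :
    (σ.face i).vertices = σ.vertices.erase (σ.1 i) := by
  ext v
  simp only [mem_vertices, face_apply, Finset.mem_erase]
  constructor
  · rintro ⟨a, rfl⟩
    exact ⟨fun h => Fin.succAbove_ne _ _ (σ.1.injective h), _, rfl⟩
  · rintro ⟨h, a, rfl⟩
    obtain ⟨b, rfl⟩ := Fin.exists_succAbove_eq (fun h' => h (congrArg σ.1 h') : a ≠ i)
    exact ⟨b, rfl⟩

theorem perm_perm (σ : OrdSimplex K k) (π ρ : Equiv.Perm (Fin (k + 1))) :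
    (σ.perm π).perm ρ = σ.perm (π * ρ) := rfl

theorem face_perm_swap (σ : OrdSimplex K (k + 1)) {a b i : Fin (k + 2)} (hab : a ≠ b)
    (ha : a ≠ i) (hb : b ≠ i) :
    ∃ a' b' : Fin (k + 1), a' ≠ b' ∧
      (σ.perm (Equiv.swap a b)).face i = (σ.face i).perm (Equiv.swap a' b') := by
  obtain ⟨a', rfl⟩ := Fin.exists_succAbove_eq ha
  obtain ⟨b', rfl⟩ := Fin.exists_succAbove_eq hb
  refine ⟨a', b', fun h => hab (by rw [h]), ext' fun x => ?_⟩
  simp only [face_apply, perm_apply]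
  congr 1
  rw [← Function.Injective.swap_apply Fin.succAbove_right_injective]

/-- Swapping two neighbouring vertices and omitting the one now in the first slot leaves the others
in their original order, with no extra permutation. This allows induction on the position of the
omitted vertex, without tracking cyclic permutations. -/
theorem face_castSucc_perm_swap (σ : OrdSimplex K (k + 1)) (i : Fin (k + 1)) :
    (σ.perm (Equiv.swap i.castSucc i.succ)).face i.castSucc = σ.face i.succ := by
  refine ext' fun x => ?_
  simp only [face_apply, perm_apply]
  congr 1
  rcases lt_trichotomy x i with h | rfl | h
  · rw [Fin.succAbove_castSucc_of_lt _ _ h, Fin.succAbove_succ_of_le _ _ h.le,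
      Equiv.swap_apply_of_ne_of_ne]
    · exact fun h' => h.ne (Fin.castSucc_injective _ h')
    · intro h'; have := congrArg Fin.val h'; simp at this; have := Fin.lt_def.1 h; omega
  · simp
  · rw [Fin.succAbove_castSucc_of_le _ _ h.le, Fin.succAbove_succ_of_lt _ _ h,
      Equiv.swap_apply_of_ne_of_ne]
    · intro h'; have := congrArg Fin.val h'; simp at this; have := Fin.lt_def.1 h; omega
    · exact fun h' => h.ne' (Fin.succ_injective _ h')

theorem face_succ_perm_swap (σ : OrdSimplex K (k + 1)) (i : Fin (k + 1)) :
    (σ.perm (Equiv.swap i.castSucc i.succ)).face i.succ = σ.face i.castSucc := by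
  rw [← face_castSucc_perm_swap, perm_perm, Equiv.swap_mul_self]
  rfl

theorem face_face (σ : OrdSimplex K (k + 2)) (i : Fin (k + 3)) (a : Fin (k + 2)) :
    (σ.face (i.succAbove a)).face (a.predAbove i) = (σ.face i).face a :=
  ext' fun x => congrArg σ.1 (Fin.succAbove_succAbove_succAbove_predAbove i a x)

end OrdSimplex

/-! ### Alternating cochains and the identity `d ∘ d = 0` -/

section Cochains

variable {V : Type*} {K : PreAbstractSimplicialComplex V} {j k l : ℕ}
variable {𝕜 E : Type*} [Ring 𝕜] [AddCommGroup E] [Module 𝕜 E]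

/-- A function on ordered simplices which changes sign under odd permutations. -/
def IsAlternating (φ : OrdSimplex K k → E) : Prop :=
  ∀ (σ : OrdSimplex K k) (π : Equiv.Perm (Fin (k + 1))),
    φ (σ.perm π) = (Equiv.Perm.sign π : ℤ) • φ σ

theorem IsAlternating.perm_swap {φ : OrdSimplex K k → E} (hφ : IsAlternating φ)
    (σ : OrdSimplex K k) {a b : Fin (k + 1)} (hab : a ≠ b) :
    φ (σ.perm (Equiv.swap a b)) = -φ σ := by
  rw [hφ, Equiv.Perm.sign_swap hab]
  simp

/-- Adjacent transpositions generate the symmetric group, even as a monoid. -/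
theorem isAlternating_of_adjacent {φ : OrdSimplex K k → E}
    (h : ∀ (σ : OrdSimplex K k) (i : Fin k),
      φ (σ.perm (Equiv.swap i.castSucc i.succ)) = -φ σ) : IsAlternating φ := by
  intro σ π
  have hπ : π ∈ Submonoid.closure (Set.range fun i : Fin k => Equiv.swap i.castSucc i.succ) := by
    rw [Equiv.Perm.mclosure_swap_castSucc_succ]
    trivial
  induction hπ using Submonoid.closure_induction generalizing σ with
  | mem x hx =>
    obtain ⟨i, rfl⟩ := hx
    simp only
    rw [h, Equiv.Perm.sign_swap (Fin.castSucc_lt_succ).ne]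
    simp
  | one =>
    have : σ.perm 1 = σ := rfl
    simp [this]
  | mul x y _ _ hx hy =>
    rw [← OrdSimplex.perm_perm, hy, hx, smul_smul]
    congr 1
    simp [mul_comm]

theorem diff_apply (φ : OrdSimplex K k → E) (σ : OrdSimplex K (k + 1)) :
    diff K 𝕜 E k φ σ = ∑ i : Fin (k + 2), (-1 : ℤ) ^ (i : ℕ) • φ (σ.face i) := rfl

/-- An adjacent transposition exchanges the two faces omitting one of the swapped vertices, whose
signs in `d` are opposite, and acts on every other face by a transposition. -/
theorem IsAlternating.diff {φ : OrdSimplex K k → E} (hφ : IsAlternating φ) :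
    IsAlternating (diff K 𝕜 E k φ) := by
  refine isAlternating_of_adjacent fun σ i => ?_
  rw [diff_apply, diff_apply, ← Finset.sum_neg_distrib]
  refine Finset.sum_equiv (Equiv.swap i.castSucc i.succ) (by simp) fun x _ => ?_
  by_cases h1 : x = i.castSucc
  · subst h1
    rw [OrdSimplex.face_castSucc_perm_swap, Equiv.swap_apply_left]
    simp [pow_succ]
  by_cases h2 : x = i.succ
  · subst h2
    rw [OrdSimplex.face_succ_perm_swap, Equiv.swap_apply_right]
    simp [pow_succ]
  rw [Equiv.swap_apply_of_ne_of_ne h1 h2]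
  obtain ⟨a', b', hab, h⟩ := σ.face_perm_swap (Fin.castSucc_lt_succ (i := i)).ne
    (Ne.symm h1) (Ne.symm h2)
  rw [h, hφ.perm_swap _ hab, smul_neg]

/-- Omitting the same two vertices in the other order is a fixed-point-free involution on the terms,
and it reverses signs. -/
theorem diff_diff (φ : OrdSimplex K k → E) : diff K 𝕜 E (k + 1) (diff K 𝕜 E k φ) = 0 := by
  funext σ
  simp only [diff_apply, Finset.smul_sum, Pi.zero_apply]
  rw [← Fintype.sum_prod_type' (fun (i : Fin (k + 3)) (a : Fin (k + 2)) =>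
      (-1 : ℤ) ^ (i : ℕ) • (-1 : ℤ) ^ (a : ℕ) • φ ((σ.face i).face a))]
  refine Finset.sum_involution (fun x _ => (x.1.succAbove x.2, x.2.predAbove x.1)) ?_ ?_ ?_ ?_
  · rintro ⟨i, a⟩ -
    simp only
    rw [OrdSimplex.face_face, smul_smul, smul_smul, ← pow_add, ← pow_add,
      Fin.neg_one_pow_succAbove_add_predAbove, neg_smul, add_neg_cancel]
  · rintro ⟨i, a⟩ - - h
    exact Fin.succAbove_ne i a (congrArg Prod.fst h)
  · simp
  · rintro ⟨i, a⟩ -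
    simp only [Fin.succAbove_succAbove_predAbove, Fin.predAbove_predAbove_succAbove]

end Cochains

/-! ## Links -/

section Link

variable {V : Type*} [DecidableEq V] (K : PreAbstractSimplicialComplex V) {j k l : ℕ}

open Classical in
/-- The vertices of the link of `s`, as a finite set (empty if there are infinitely many). -/
noncomputable def linkFinset (s : Finset V) : Finset V :=
  if h : {v | v ∉ s ∧ insert v s ∈ K.faces}.Finite then h.toFinset else ∅

variable {K}

theorem prop_of_mem_linkFinset {s : Finset V} {v : V} (h : v ∈ linkFinset K s) :
    v ∉ s ∧ insert v s ∈ K.faces := by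
  unfold linkFinset at h
  split_ifs at h
  · simpa using h
  · simp at h

theorem mem_linkFinset (hK : IsLocallyFinite K) {s : Finset V} (hs : s.Nonempty) {v : V} :
    v ∈ linkFinset K s ↔ v ∉ s ∧ insert v s ∈ K.faces := by
  refine ⟨prop_of_mem_linkFinset, fun h => ?_⟩
  have hfin : {v | v ∉ s ∧ insert v s ∈ K.faces}.Finite := by
    obtain ⟨w, hw⟩ := hs
    refine ((hK w).biUnion fun t _ => t.finite_toSet).subset ?_
    rintro v ⟨-, hv⟩
    simp only [Set.mem_iUnion]
    exact ⟨insert v s, ⟨hv, Finset.mem_insert_of_mem hw⟩, by simp⟩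
  unfold linkFinset
  rw [dif_pos hfin]
  simpa using h

/-- The ordered simplex `vτ`. -/
def OrdSimplex.cons (τ : OrdSimplex K k) (v : linkFinset K τ.vertices) : OrdSimplex K (k + 1) :=
  ⟨⟨Fin.cons v.1 τ.1, by
    have h := (prop_of_mem_linkFinset v.2).1
    rw [Fin.cons_injective_iff]
    refine ⟨?_, τ.1.injective⟩
    rintro ⟨i, hi⟩
    exact h (hi ▸ τ.apply_mem_vertices i)⟩, by
    have h := (prop_of_mem_linkFinset v.2).2
    convert h using 1
    ext w
    simp [Fin.exists_fin_succ, OrdSimplex.mem_vertices, eq_comm]⟩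

@[simp] theorem OrdSimplex.cons_zero (τ : OrdSimplex K k) (v) : (τ.cons v).1 0 = v.1 := rfl

@[simp] theorem OrdSimplex.cons_succ (τ : OrdSimplex K k) (v) (i : Fin (k + 1)) :
    (τ.cons v).1 i.succ = τ.1 i := rfl

@[simp] theorem OrdSimplex.cons_face_zero (τ : OrdSimplex K k) (v) : (τ.cons v).face 0 = τ :=
  OrdSimplex.ext' fun i => by simp

@[simp] theorem OrdSimplex.vertices_cons (τ : OrdSimplex K k) (v) :
    (τ.cons v).vertices = insert v.1 τ.vertices := by
  ext w
  simp [Fin.exists_fin_succ, OrdSimplex.mem_vertices, eq_comm]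

theorem OrdSimplex.exists_cons (hK : IsLocallyFinite K) (σ : OrdSimplex K (k + 1)) :
    ∃ v : linkFinset K (σ.face 0).vertices, (σ.face 0).cons v = σ := by
  refine ⟨⟨σ.1 0, ?_⟩, ?_⟩
  · rw [mem_linkFinset hK (σ.face 0).vertices_nonempty, vertices_face]
    refine ⟨Finset.notMem_erase _ _, ?_⟩
    rw [Finset.insert_erase (σ.apply_mem_vertices 0)]
    exact σ.vertices_mem
  · refine ext' fun i => ?_
    cases i using Fin.cases with
    | zero => rfl
    | succ i => simp

theorem OrdSimplex.cons_injective (τ : OrdSimplex K k) : Function.Injective τ.cons := by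
  intro v w h
  have := congrArg (fun σ => σ.1 0) h
  exact Subtype.ext this

/-- The ordered simplices `vτ`. -/
noncomputable def coface (τ : OrdSimplex K k) : Finset (OrdSimplex K (k + 1)) :=
  Finset.univ.map ⟨τ.cons, τ.cons_injective⟩

theorem mem_coface (hK : IsLocallyFinite K) (σ : OrdSimplex K (k + 1)) (τ : OrdSimplex K k) :
    σ ∈ coface τ ↔ σ.face 0 = τ := by
  simp only [coface, Finset.mem_map, Finset.mem_univ, true_and, Function.Embedding.coeFn_mk]
  constructor
  · rintro ⟨v, rfl⟩
    simp
  · rintro rfl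
    exact σ.exists_cons hK

theorem sum_coface {E : Type*} [AddCommMonoid E] (τ : OrdSimplex K k)
    (F : OrdSimplex K (k + 1) → E) :
    ∑ σ ∈ coface τ, F σ = ∑ v : linkFinset K τ.vertices, F (τ.cons v) := by
  simp [coface]

/-! ## Counting top-dimensional simplices -/

variable {n : ℕ}

theorem topCount_finite (hK : IsLocallyFinite K) {s : Finset V} (hs : s.Nonempty) :
    {t ∈ K.faces | t.card = n + 1 ∧ s ⊆ t}.Finite := by
  obtain ⟨v, hv⟩ := hs
  exact (hK v).subset fun t ht => ⟨ht.1, ht.2.2 hv⟩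

/-- The `n`-simplices containing `vτ` for some `v` are counted once for each of their vertices
outside `τ`. -/
theorem sum_topCount_insert (hK : IsLocallyFinite K) {s : Finset V} (hs : s.Nonempty) :
    ∑ v ∈ linkFinset K s, topCount K n (insert v s) = (n + 1 - s.card) * topCount K n s := by
  classical
  have hfin := topCount_finite (n := n) hK hs
  have h1 : ∀ v ∈ linkFinset K s, topCount K n (insert v s) =
      (hfin.toFinset.filter fun t => v ∈ t).card := by
    intro v _
    rw [topCount, ← Set.ncard_coe_finset]
    congr 1
    ext t
    simp only [Finset.insert_subset_iff, Finset.coe_filter, Set.Finite.mem_toFinset,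
      Set.mem_ofPred_eq]
    tauto
  rw [Finset.sum_congr rfl h1]
  simp only [Finset.card_filter]
  rw [Finset.sum_comm]
  -- Double counting of the pairs of a vertex `v` outside `s` and an `n`-simplex `t` containing `s`
  -- and `v`: for fixed `t`, every vertex of `t` outside `s` belongs to the link.
  have h2 : ∀ t ∈ hfin.toFinset,
      (∑ v ∈ linkFinset K s, if v ∈ t then 1 else 0) = n + 1 - s.card := by
    intro t ht
    rw [Set.Finite.mem_toFinset] at ht
    obtain ⟨ht1, ht2, ht3⟩ := ht
    rw [← Finset.card_filter, ← ht2, ← Finset.card_sdiff_of_subset ht3]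
    congr 1
    ext v
    simp only [Finset.mem_filter, mem_linkFinset hK hs, Finset.mem_sdiff]
    constructor
    · rintro ⟨⟨h, -⟩, h'⟩
      exact ⟨h', h⟩
    · rintro ⟨h, h'⟩
      exact ⟨⟨h', (K.isRelLowerSet_faces ht1).2 (Finset.insert_subset h ht3)
        (Finset.insert_nonempty _ _)⟩, h⟩
  rw [Finset.sum_congr rfl h2, Finset.sum_const, smul_eq_mul, mul_comm, topCount,
    ← Set.ncard_eq_toFinset_card _ hfin]

theorem topCount_eq_zero {s : Finset V} (h : s ∉ K.faces) (hs : s.Nonempty) :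
    topCount K n s = 0 := by
  have : {t ∈ K.faces | t.card = n + 1 ∧ s ⊆ t} = ∅ := by
    ext t
    simp only [Set.mem_ofPred_eq, Set.mem_empty_iff_false, iff_false]
    rintro ⟨h1, -, h2⟩
    exact h ((K.isRelLowerSet_faces h1).2 h2 hs)
  rw [topCount, this, Set.ncard_empty]

end Link

/-! ## Equivariance -/

section Equivariance

variable {V : Type*} [DecidableEq V] {Γ : Type*} [Group Γ] [MulAction Γ V]
  {X : PreAbstractSimplicialComplex V} [IsSimplicialAction Γ X] {j k l n : ℕ}

@[simp] theorem smul_ordSimplex_apply (g : Γ) (σ : OrdSimplex X k) (i) :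
    (g • σ).1 i = g • σ.1 i := rfl

theorem smul_reindex (g : Γ) (σ : OrdSimplex X l) (e : Fin (k + 1) ↪ Fin (l + 1)) :
    (g • σ).reindex e = g • σ.reindex e := rfl

theorem smul_face (g : Γ) (σ : OrdSimplex X (k + 1)) (i) :
    (g • σ).face i = g • σ.face i := rfl

theorem smul_perm (g : Γ) (σ : OrdSimplex X k) (π : Equiv.Perm (Fin (k + 1))) :
    (g • σ).perm π = g • σ.perm π := rfl

theorem vertices_smul (g : Γ) (σ : OrdSimplex X k) : (g • σ).vertices = g • σ.vertices := by
  ext v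
  simp only [OrdSimplex.mem_vertices, smul_ordSimplex_apply, Finset.mem_smul_finset]
  constructor
  · rintro ⟨i, rfl⟩
    exact ⟨_, ⟨i, rfl⟩, rfl⟩
  · rintro ⟨_, ⟨i, rfl⟩, rfl⟩
    exact ⟨i, rfl⟩

variable (X) in
theorem smul_mem_faces_iff (g : Γ) (s : Finset V) : g • s ∈ X.faces ↔ s ∈ X.faces := by
  refine ⟨fun h => ?_, IsSimplicialAction.smul_mem g s⟩
  have := IsSimplicialAction.smul_mem (X := X) g⁻¹ _ h
  rwa [inv_smul_smul] at this

variable (X) in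
theorem topCount_smul (g : Γ) (s : Finset V) : topCount X n (g • s) = topCount X n s := by
  unfold topCount
  rw [← Set.ncard_image_of_injective {t ∈ X.faces | t.card = n + 1 ∧ s ⊆ t}
    (MulAction.injective g : Function.Injective fun t : Finset V => g • t)]
  congr 1
  ext t
  simp only [Set.mem_ofPred_eq, Set.mem_image]
  constructor
  · rintro ⟨h1, h2, h3⟩
    refine ⟨g⁻¹ • t, ⟨(smul_mem_faces_iff X g⁻¹ t).2 h1, by simpa using h2, ?_⟩, by simp⟩
    rwa [Finset.subset_smul_finset_iff, inv_inv]
  · rintro ⟨t, ⟨h1, h2, h3⟩, rfl⟩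
    exact ⟨(smul_mem_faces_iff X g t).2 h1, by simpa using h2,
      Finset.smul_finset_subset_smul_finset h3⟩

theorem mem_linkFinset_smul (hX : IsLocallyFinite X) (g : Γ) {s : Finset V} (hs : s.Nonempty)
    (v : V) : g • v ∈ linkFinset X (g • s) ↔ v ∈ linkFinset X s := by
  rw [mem_linkFinset hX hs, mem_linkFinset hX hs.smul_finset, Finset.smul_mem_smul_finset_iff,
    ← Finset.smul_finset_insert, smul_mem_faces_iff]

/-- The stabilizer of an ordered simplex fixes each vertex, so it is a finite intersection of vertex
stabilizers, hence open. An open subgroup is closed, so it is compact inside a compact vertex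
stabilizer. -/
theorem hasCompactOpenStabilizers [TopologicalSpace Γ] [IsTopologicalGroup Γ]
    (hΓ : IsProperAction Γ X) (k : ℕ) : HasCompactOpenStabilizers Γ (OrdSimplex X k) := by
  intro σ
  have h1 : (MulAction.stabilizer Γ σ : Set Γ) =
      ⋂ i, (MulAction.stabilizer Γ (σ.1 i) : Set Γ) := by
    ext g
    simp only [SetLike.mem_coe, MulAction.mem_stabilizer_iff, Set.mem_iInter]
    exact ⟨fun h i => congrArg (fun τ : OrdSimplex X k => τ.1 i) h, fun h => OrdSimplex.ext' h⟩
  have h2 : ∀ i, {σ.1 i} ∈ X.faces := fun i =>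
    (X.isRelLowerSet_faces σ.vertices_mem).2
      (Finset.singleton_subset_iff.2 (σ.apply_mem_vertices i)) (Finset.singleton_nonempty _)
  have h3 : IsOpen (MulAction.stabilizer Γ σ : Set Γ) := by
    rw [h1]
    exact isOpen_iInter_of_finite fun i => (hΓ _ (h2 i)).2
  refine ⟨?_, h3⟩
  refine (hΓ _ (h2 0)).1.of_isClosed_subset
    (Subgroup.isClosed_of_isOpen (MulAction.stabilizer Γ σ) h3) ?_
  rw [h1]
  exact Set.iInter_subset _ 0

end Equivariance

/-! ## Linear algebra -/

section LinearAlgebra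

open Finset

/-- An operator between Hilbert spaces is onto if its adjoint is bounded below. -/
theorem surjective_of_adjoint_bounded_below {E F : Type*} [NormedAddCommGroup E]
    [InnerProductSpace ℝ E] [CompleteSpace E] [NormedAddCommGroup F] [InnerProductSpace ℝ F]
    [CompleteSpace F] (T : E →L[ℝ] F) {c : ℝ} (hc : 0 < c)
    (h : ∀ z : F, ∃ e : E, c * ‖z‖ ≤ ‖e‖ ∧ ∀ e', inner ℝ e e' = inner ℝ z (T e')) :
    Function.Surjective T := by
  have h1 : ∀ z, c * ‖z‖ ≤ ‖T.adjoint z‖ := by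
    intro z
    obtain ⟨e, he, he'⟩ := h z
    have : T.adjoint z = e := ext_inner_right ℝ fun v => by
      rw [ContinuousLinearMap.adjoint_inner_left, he']
    rwa [this]
  -- Since `⟪T T* z, z⟫ = ‖T* z‖² ≥ c² ‖z‖²`, the Lax–Milgram theorem makes `T T*` onto, and hence
  -- `T`.
  have h2 : IsCoercive (LinearMap.mkContinuous₂ (innerₗ F ∘ₗ (T ∘L T.adjoint).toLinearMap)
      ‖T ∘L T.adjoint‖ (fun x y => by
        refine (norm_inner_le_norm _ _).trans ?_
        exact mul_le_mul_of_nonneg_right ((T ∘L T.adjoint).le_opNorm x) (norm_nonneg y))) := by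
    refine ⟨c ^ 2, by positivity, fun z => ?_⟩
    change c ^ 2 * ‖z‖ * ‖z‖ ≤ inner ℝ (T (T.adjoint z)) z
    rw [← ContinuousLinearMap.adjoint_inner_right, real_inner_self_eq_norm_sq]
    have h3 := h1 z
    have h4 : 0 ≤ c * ‖z‖ := by positivity
    nlinarith
  intro z
  obtain ⟨w, hw⟩ := h2.continuousLinearEquivOfBilin.surjective z
  refine ⟨T.adjoint w, ?_⟩
  rw [← hw]
  refine ext_inner_right ℝ fun v => ?_
  rw [IsCoercive.continuousLinearEquivOfBilin_apply]
  rfl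

/-- Finitely many vectors of an inner product space have coordinates. -/
theorem exists_coordinates {ι H : Type*} [Finite ι] [NormedAddCommGroup H]
    [InnerProductSpace ℝ H] (x : ι → H) :
    ∃ (m : ℕ) (L : Fin m → H →ₗ[ℝ] ℝ), ∀ y ∈ Submodule.span ℝ (Set.range x),
      ‖y‖ ^ 2 = ∑ a, L a y ^ 2 := by
  have : FiniteDimensional ℝ (Submodule.span ℝ (Set.range x)) :=
    FiniteDimensional.span_of_finite ℝ (Set.finite_range x)
  let b := stdOrthonormalBasis ℝ (Submodule.span ℝ (Set.range x))
  refine ⟨_, fun a => innerₗ H (b a : H), fun y hy => ?_⟩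
  have h := b.sum_sq_norm_inner_right ⟨y, hy⟩
  simp only [Submodule.coe_inner, Real.norm_eq_abs, sq_abs] at h
  rw [Submodule.coe_norm] at h
  exact h.symm

/-! ### The Poincaré inequality on a finite weighted graph -/

section Graph

variable {ι : Type*} [Fintype ι] (a : ι → ι → ℝ) (ha : ∀ u v, a u v = a v u)

include ha in
theorem sum_mul_laplacian (f : ι → ℝ) :
    ∑ u, f u * ∑ v, a u v * (f u - f v) = 1 / 2 * ∑ u, ∑ v, a u v * (f u - f v) ^ 2 := by
  have h1 : ∑ u, f u * ∑ v, a u v * (f u - f v) = ∑ u, ∑ v, a u v * (f u * (f u - f v)) := by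
    refine sum_congr rfl fun u _ => ?_
    rw [mul_sum]
    exact sum_congr rfl fun v _ => by ring
  have h2 : ∑ u, ∑ v, a u v * (f u * (f u - f v)) = ∑ u, ∑ v, a u v * (f v * (f v - f u)) := by
    rw [sum_comm]
    exact sum_congr rfl fun u _ => sum_congr rfl fun v _ => by rw [ha]
  have h3 : ∑ u, ∑ v, a u v * (f u - f v) ^ 2 =
      ∑ u, ∑ v, a u v * (f u * (f u - f v)) + ∑ u, ∑ v, a u v * (f v * (f v - f u)) := by
    rw [← sum_add_distrib]
    refine sum_congr rfl fun u _ => ?_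
    rw [← sum_add_distrib]
    exact sum_congr rfl fun v _ => by ring
  rw [h1, h3, ← h2]
  ring

include ha in
theorem sum_laplacian (f : ι → ℝ) : ∑ u, ∑ v, a u v * (f u - f v) = 0 := by
  have h2 : ∑ u, ∑ v, a u v * (f u - f v) = ∑ u, ∑ v, -(a u v * (f u - f v)) := by
    rw [sum_comm]
    exact sum_congr rfl fun u _ => sum_congr rfl fun v _ => by rw [ha]; ring
  simp only [sum_neg_distrib] at h2
  linarith

variable (ha0 : ∀ u v, 0 ≤ a u v) {b : ι → ℝ} (hb : ∀ u, 0 < b u)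
    (hconn : ∀ f : ι → ℝ, (∀ u v, a u v ≠ 0 → f u = f v) → ∀ u v, f u = f v)
    {lam : ℝ} (hlam : ∀ x : ℝ, 0 < x → ∀ f : ι → ℝ, f ≠ 0 →
      (∀ u, ∑ v, a u v * (f u - f v) = x * (b u * f u)) → lam ≤ x)

include ha ha0 hb hconn hlam in
/-- An eigenvalue, with respect to the weights `b`, of the quadratic form
`E - lam * Var` on a connected weighted graph is nonnegative. -/
theorem eigenvalue_nonneg_of_graph {f : ι → ℝ} (hf : f ≠ 0) {x : ℝ}
    (h : ∀ u, ∑ v, a u v * (f u - f v) - lam * (b u * f u)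
      + lam * (b u * ∑ v, b v * f v) / ∑ v, b v = x * (b u * f u)) : 0 ≤ x := by
  obtain ⟨u₀, hu₀⟩ := Function.ne_iff.1 hf
  have hB : 0 < ∑ v, b v := sum_pos (fun u _ => hb u) ⟨u₀, mem_univ _⟩
  -- Sum the eigenvalue equation over all vertices. The Laplacian sums to zero by symmetry of `a`,
  -- and the two terms with `lam` cancel. Hence either `x = 0` or `f` has weighted mean zero.
  have h1 : x * ∑ v, b v * f v = 0 := by
    rw [mul_sum, ← sum_congr rfl fun u _ => h u, sum_add_distrib, sum_sub_distrib,
      sum_laplacian a ha, ← mul_sum, ← sum_div, ← mul_sum, ← sum_mul]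
    field_simp
    ring
  rcases mul_eq_zero.1 h1 with h2 | h2
  · exact h2.ge
  -- With mean zero, `f` is an eigenfunction of the Laplacian itself, with eigenvalue `x + lam`.
  -- This is nonnegative; it is not zero, since `f` would then be constant with mean zero; so it is
  -- at least `lam`.
  have h3 : ∀ u, ∑ v, a u v * (f u - f v) = (x + lam) * (b u * f u) := by
    intro u
    have := h u
    rw [h2] at this
    simp only [mul_zero, zero_div, add_zero] at this
    linarith
  have h4 := sum_mul_laplacian a ha f
  simp only [h3] at h4
  have h5 : ∑ u, f u * ((x + lam) * (b u * f u)) = (x + lam) * ∑ u, b u * f u ^ 2 := by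
    rw [mul_sum]
    exact sum_congr rfl fun u _ => by ring
  rw [h5] at h4
  have h6 : 0 < ∑ u, b u * f u ^ 2 :=
    sum_pos' (fun u _ => mul_nonneg (hb u).le (sq_nonneg _))
      ⟨u₀, mem_univ _, mul_pos (hb u₀) (sq_pos_of_ne_zero hu₀)⟩
  have h7 : ∀ u v, 0 ≤ a u v * (f u - f v) ^ 2 := fun u v => mul_nonneg (ha0 u v) (sq_nonneg _)
  have h8 : 0 ≤ ∑ u, ∑ v, a u v * (f u - f v) ^ 2 :=
    sum_nonneg fun u _ => sum_nonneg fun v _ => h7 u v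
  have h9 : 0 ≤ x + lam := by
    by_contra h10
    have := mul_neg_of_neg_of_pos (not_le.1 h10) h6
    linarith
  rcases h9.eq_or_lt with h10 | h10
  · exfalso
    rw [← h10, zero_mul] at h4
    have h11 : ∑ u, ∑ v, a u v * (f u - f v) ^ 2 = 0 := by linarith
    have h12 : ∀ u v, f u = f v := by
      refine hconn f fun u v huv => ?_
      rw [sum_eq_zero_iff_of_nonneg fun u _ => sum_nonneg fun v _ => h7 u v] at h11
      have h13 := h11 u (mem_univ _)
      rw [sum_eq_zero_iff_of_nonneg fun v _ => h7 u v] at h13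
      have h14 := h13 v (mem_univ _)
      rcases mul_eq_zero.1 h14 with h15 | h15
      · exact absurd h15 huv
      · exact sub_eq_zero.1 (pow_eq_zero_iff two_ne_zero |>.1 h15)
    have h13 : ∑ v, b v * f v = (∑ v, b v) * f u₀ := by
      rw [sum_mul]
      exact sum_congr rfl fun v _ => by rw [h12 v u₀]
    rw [h2] at h13
    exact (mul_ne_zero hB.ne' hu₀) h13.symm
  · have := hlam _ h10 f hf h3
    linarith

include ha ha0 hb hconn hlam in
/-- The Poincaré inequality on a connected weighted graph, `lam` being at most the
smallest positive eigenvalue of the Laplacian. -/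
theorem poincare_real (f : ι → ℝ) :
    lam * (∑ u, b u * f u ^ 2 - (∑ u, b u * f u) ^ 2 / ∑ u, b u) ≤
      1 / 2 * ∑ u, ∑ v, a u v * (f u - f v) ^ 2 := by
  classical
  let r : ι → ℝ := fun u => √(b u)
  have hr : ∀ u, 0 < r u := fun u => Real.sqrt_pos.2 (hb u)
  have hrr : ∀ u, b u = r u * r u := fun u => (Real.mul_self_sqrt (hb u).le).symm
  set B := ∑ u, b u with hB
  -- The matrix of the quadratic form given by the right side of the inequality minus the left. It
  -- is conjugated below by `√b`, so that the eigenvalue problem relative to the weights `b` becomes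
  -- that of a symmetric matrix `A`.
  let Q : ι → ι → ℝ := fun u v =>
    (if u = v then ∑ w, a u w - lam * b u else 0) - a u v + lam * (b u * b v) / B
  have hQ : ∀ (g : ι → ℝ) u, ∑ v, Q u v * g v = ∑ v, a u v * (g u - g v) - lam * (b u * g u)
      + lam * (b u * ∑ v, b v * g v) / B := by
    intro g u
    simp only [Q, add_mul, sub_mul, ite_mul, zero_mul, sum_add_distrib, sum_sub_distrib,
      sum_ite_eq, mem_univ, if_true, mul_sub]
    rw [← sum_mul, mul_sum, mul_sum, sum_div]
    have : ∑ i, lam * (b u * b i) / B * g i = ∑ i, lam * (b u * (b i * g i)) / B :=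
      sum_congr rfl fun i _ => by ring
    rw [this]
    ring
  let A : Matrix ι ι ℝ := Matrix.of fun u v => Q u v / (r u * r v)
  have hA : A.IsHermitian := by
    ext u v
    simp only [A, Q, Matrix.conjTranspose_apply, Matrix.of_apply, star_trivial]
    rw [ha v u, mul_comm (b v), mul_comm (r v)]
    by_cases huv : u = v
    · subst huv; rfl
    · rw [if_neg huv, if_neg (Ne.symm huv)]
  have hpos : A.PosSemidef := by
    rw [hA.posSemidef_iff_eigenvalues_nonneg]
    intro i
    let y := hA.eigenvectorBasis i
    have hy := hA.mulVec_eigenvectorBasis i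
    have hy0 : y ≠ 0 := fun h => by
      have := hA.eigenvectorBasis.orthonormal.1 i
      rw [show hA.eigenvectorBasis i = 0 from h] at this
      simp at this
    change 0 ≤ hA.eigenvalues i
    refine eigenvalue_nonneg_of_graph a ha ha0 hb hconn hlam (f := fun u => y u / r u) ?_ ?_
    · intro h
      apply hy0
      ext u
      have := congrFun h u
      simp only [Pi.zero_apply, div_eq_zero_iff, (hr u).ne', or_false] at this
      simpa using this
    · intro u
      rw [← hB]
      refine (hQ (fun u => y u / r u) u).symm.trans ?_
      have h1 := congrFun hy u
      simp only [Matrix.mulVec, dotProduct, A, Matrix.of_apply, Pi.smul_apply, smul_eq_mul] at h1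
      have h2 : ∑ v, Q u v * (y v / r v) = r u * ∑ v, Q u v / (r u * r v) * y v := by
        rw [mul_sum]
        refine sum_congr rfl fun v _ => ?_
        have := (hr u).ne'
        have := (hr v).ne'
        field_simp
      rw [h2]
      erw [h1]
      rw [hrr u]
      have := (hr u).ne'
      field_simp
      rfl
  have h1 := hpos.dotProduct_mulVec_nonneg (fun u => r u * f u)
  simp only [star_trivial, Matrix.mulVec, dotProduct, A, Matrix.of_apply] at h1
  have h2 : ∑ u, r u * f u * ∑ v, Q u v / (r u * r v) * (r v * f v) =
      ∑ u, f u * ∑ v, Q u v * f v := by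
    refine sum_congr rfl fun u _ => ?_
    rw [mul_sum, mul_sum]
    refine sum_congr rfl fun v _ => ?_
    have := (hr u).ne'
    have := (hr v).ne'
    field_simp
  rw [h2] at h1
  simp only [hQ, mul_add, mul_sub, sum_add_distrib, sum_sub_distrib] at h1
  have h3 := sum_mul_laplacian a ha f
  simp only [mul_sub, sum_sub_distrib] at h3
  have h4 : ∑ u, f u * (lam * (b u * f u)) = lam * ∑ u, b u * f u ^ 2 := by
    rw [mul_sum]; exact sum_congr rfl fun u _ => by ring
  have h5 : ∑ u, f u * (lam * (b u * ∑ v, b v * f v) / B) =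
      lam * ((∑ u, b u * f u) ^ 2 / B) := by
    have : ∀ u, f u * (lam * (b u * ∑ v, b v * f v) / B) =
        b u * f u * (lam * (∑ v, b v * f v) / B) := fun u => by ring
    rw [sum_congr rfl fun u _ => this u, ← sum_mul]
    ring
  rw [h4, h5] at h1
  rw [← h3]
  linarith

include ha ha0 hb hconn hlam in
/-- The Poincaré inequality for functions with values in a Hilbert space. -/
theorem poincare {H : Type*} [NormedAddCommGroup H] [InnerProductSpace ℝ H] (f : ι → H) :
    lam * (∑ u, b u * ‖f u‖ ^ 2 - ‖∑ u, b u • f u‖ ^ 2 / ∑ u, b u) ≤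
      1 / 2 * ∑ u, ∑ v, a u v * ‖f u - f v‖ ^ 2 := by
  -- Both sides involve only squared norms of linear combinations of the values of `f`, so the real
  -- inequalities for the coordinates in the span of these values can be added.
  obtain ⟨m, L, hL⟩ := exists_coordinates f
  have hf : ∀ u, f u ∈ Submodule.span ℝ (Set.range f) :=
    fun u => Submodule.subset_span ⟨u, rfl⟩
  rw [hL _ (Submodule.sum_mem _ fun u _ => Submodule.smul_mem _ _ (hf u))]
  simp only [hL _ (hf _), hL _ (Submodule.sub_mem _ (hf _) (hf _)), map_sum, map_smul, map_sub,
    smul_eq_mul]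
  have h := sum_le_sum fun i (_ : i ∈ univ) =>
    poincare_real a ha ha0 hb hconn hlam fun u => L i (f u)
  rw [← mul_sum, sum_sub_distrib, ← sum_div, ← mul_sum] at h
  have h1 : ∑ i, ∑ u, b u * L i (f u) ^ 2 = ∑ u, b u * ∑ i, L i (f u) ^ 2 := by
    rw [sum_comm]; simp only [mul_sum]
  have h2 : ∑ i, ∑ u, ∑ v, a u v * (L i (f u) - L i (f v)) ^ 2 =
      ∑ u, ∑ v, a u v * ∑ i, (L i (f u) - L i (f v)) ^ 2 := by
    rw [sum_comm]
    refine sum_congr rfl fun u _ => ?_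
    rw [sum_comm]; simp only [mul_sum]
  rwa [h1, h2] at h

end Graph

end LinearAlgebra

/-! ### Bordered determinants and quadratic forms on a kernel -/

section BorderedDet

variable {F F' : Type*} [Fintype F] [Fintype F'] [DecidableEq F] [DecidableEq F']
  (B : Matrix F F' ℝ) (s : F → ℝ) {ε : ℝ}

/-- The bordered matrix is singular at the eigenvalues of the compression of `diag s` to
the orthogonal complement of the columns of `B`. -/
theorem det_bordered_eq_zero {x : ℝ} {y : F → ℝ} {z : F' → ℝ} (hy : y ≠ 0)
    (h1 : ∀ f, (x - s f) * y f + ∑ ν, B f ν * z ν = 0) (h2 : ∀ ν, ∑ f, B f ν * y f = 0) :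
    (Matrix.fromBlocks (Matrix.diagonal fun f => x - s f) B B.transpose 0).det = 0 := by
  rw [← Matrix.exists_mulVec_eq_zero_iff]
  refine ⟨Sum.elim y z, fun h => hy ?_, ?_⟩
  · funext f
    exact congrFun h (Sum.inl f)
  · rw [Matrix.fromBlocks_mulVec]
    funext t
    cases t with
    | inl f =>
      have := h1 f
      simp only [Sum.elim_comp_inl, Sum.elim_comp_inr, Sum.elim_inl, Pi.add_apply,
        Matrix.mulVec_diagonal, Pi.zero_apply]
      simpa [Matrix.mulVec, dotProduct] using this
    | inr ν =>
      simpa [Matrix.mulVec, dotProduct] using h2 ν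

variable (h : ∀ x : ℝ,
  (Matrix.fromBlocks (Matrix.diagonal fun f => x - s f) B B.transpose 0).det = 0 → ε ≤ x)

include h in
-- Diagonalize the compression of `diag s` to the kernel of `Bᵀ`: each of its eigenvalues is a root
-- of the bordered determinant, hence at least `ε`. Independence of the columns of `B` is not
-- assumed; if they are dependent, the determinant vanishes for every `x` and `h` is contradictory.
theorem le_form_of_det {y : F → ℝ} (hy : ∀ ν, ∑ f, B f ν * y f = 0) :
    ε * ∑ f, y f ^ 2 ≤ ∑ f, s f * y f ^ 2 := by
  let BL := Matrix.toEuclideanLin B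
  let U : Submodule ℝ (EuclideanSpace ℝ F) := LinearMap.range BL
  let D := Matrix.toEuclideanLin (Matrix.diagonal s)
  have hD : ∀ (v : EuclideanSpace ℝ F) f, D v f = s f * v f := fun v f => by
    simp [D, Matrix.toEuclideanLin, Matrix.mulVec_diagonal]
  have hBL : ∀ (v : EuclideanSpace ℝ F') f, BL v f = ∑ ν, B f ν * v ν := fun v f => by
    simp [BL, Matrix.toEuclideanLin, Matrix.mulVec, dotProduct]
  have hin : ∀ v w : EuclideanSpace ℝ F, inner ℝ v w = ∑ f, v f * w f := fun v w => by
    simp [PiLp.inner_apply, mul_comm]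
  have hDs : ∀ v w : EuclideanSpace ℝ F, inner ℝ (D v) w = inner ℝ v (D w) := fun v w => by
    rw [hin, hin]
    exact Finset.sum_congr rfl fun f _ => by rw [hD, hD]; ring
  have hW : ∀ v : EuclideanSpace ℝ F, v ∈ Uᗮ ↔ ∀ ν, ∑ f, B f ν * v f = 0 := by
    intro v
    rw [Submodule.mem_orthogonal]
    constructor
    · intro hv ν
      have := hv (BL (EuclideanSpace.single ν 1)) ⟨_, rfl⟩
      rw [hin] at this
      simpa [hBL] using this
    · rintro hv _ ⟨z, rfl⟩
      rw [hin]
      simp only [hBL, Finset.sum_mul]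
      rw [Finset.sum_comm]
      refine Finset.sum_eq_zero fun ν _ => ?_
      have : ∑ f, B f ν * z ν * v f = z ν * ∑ f, B f ν * v f := by
        rw [Finset.mul_sum]; exact Finset.sum_congr rfl fun f _ => by ring
      rw [this, hv, mul_zero]
  let T : Uᗮ →ₗ[ℝ] Uᗮ := Uᗮ.orthogonalProjectionOnto.toLinearMap ∘ₗ D ∘ₗ Uᗮ.subtype
  have hTin : ∀ v w : Uᗮ, inner ℝ (T v) w = inner ℝ (D v) (w : EuclideanSpace ℝ F) := by
    intro v w
    exact Submodule.inner_orthogonalProjectionOnto_eq_of_mem_right w (D v)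
  have hT : T.IsSymmetric := by
    intro v w
    rw [hTin, ← real_inner_comm v, hTin, hDs, real_inner_comm]
  let e := hT.eigenvectorBasis rfl
  have heig : ∀ i, ε ≤ hT.eigenvalues rfl i := by
    intro i
    have h1 : T (e i) = hT.eigenvalues rfl i • e i := hT.apply_eigenvectorBasis rfl i
    -- An eigenvector of the compression satisfies the eigenvalue equation of `D` modulo the range
    -- `U` of `B`. A preimage `z` of the error supplies the second component of a kernel vector of
    -- the bordered matrix.
    have h2 : D (e i) - hT.eigenvalues rfl i • (e i : EuclideanSpace ℝ F) ∈ U := by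
      refine (Submodule.orthogonal_orthogonal U).le ((Submodule.mem_orthogonal _ _).2 ?_)
      intro w hw
      rw [real_inner_comm, inner_sub_left, ← hTin (e i) ⟨w, hw⟩, h1]
      simp [inner_smul_left]
    obtain ⟨z, hz⟩ := h2
    refine h _ (det_bordered_eq_zero B s (y := (e i : EuclideanSpace ℝ F)) (z := z) ?_ ?_
      ((hW _).1 (e i).2))
    · intro h3
      have h4 := e.orthonormal.1 i
      have : e i = 0 := Subtype.ext (by ext f; exact congrFun h3 f)
      rw [this] at h4
      simp at h4
    · intro f
      have := congrArg (fun v : EuclideanSpace ℝ F => v f) hz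
      simp only [hBL, PiLp.sub_apply, hD, PiLp.smul_apply, smul_eq_mul] at this
      rw [this]
      ring
  let v : Uᗮ := ⟨WithLp.toLp 2 y, (hW _).2 hy⟩
  have h1 : inner ℝ (T v) v = ∑ f, s f * y f ^ 2 := by
    rw [hTin, hin]
    refine Finset.sum_congr rfl fun f _ => ?_
    rw [hD]
    simp only [v]
    ring
  have h2 : ‖v‖ ^ 2 = ∑ f, y f ^ 2 := by
    rw [← real_inner_self_eq_norm_sq, Submodule.coe_inner, hin]
    refine Finset.sum_congr rfl fun f _ => ?_
    simp only [v]
    ring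
  rw [← h1, ← h2, ← e.sum_inner_mul_inner, ← e.sum_sq_norm_inner_right, Finset.mul_sum]
  refine Finset.sum_le_sum fun i _ => ?_
  have h3 : inner ℝ (T v) (e i) = hT.eigenvalues rfl i * inner ℝ (e i) v := by
    rw [hT, show T (e i) = hT.eigenvalues rfl i • e i from hT.apply_eigenvectorBasis rfl i,
      inner_smul_right, real_inner_comm]
  rw [h3, Real.norm_eq_abs, sq_abs]
  have := mul_le_mul_of_nonneg_right (heig i) (sq_nonneg (inner ℝ (e i) v))
  linarith

include h in
theorem le_form_of_det_of_vector {H : Type*} [NormedAddCommGroup H] [InnerProductSpace ℝ H]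
    {y : F → H} (hy : ∀ ν, ∑ f, B f ν • y f = 0) :
    ε * ∑ f, ‖y f‖ ^ 2 ≤ ∑ f, s f * ‖y f‖ ^ 2 := by
  obtain ⟨m, L, hL⟩ := exists_coordinates y
  have hf : ∀ u, y u ∈ Submodule.span ℝ (Set.range y) :=
    fun u => Submodule.subset_span ⟨u, rfl⟩
  simp only [hL _ (hf _)]
  have h0 := Finset.sum_le_sum fun i (_ : i ∈ Finset.univ) =>
    le_form_of_det B s h (y := fun f => L i (y f)) fun ν => by
      have := congrArg (L i) (hy ν)
      simpa [map_sum] using this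
  rw [← Finset.mul_sum, Finset.sum_comm] at h0
  refine h0.trans (le_of_eq ?_)
  rw [Finset.sum_comm]
  simp only [Finset.mul_sum]

end BorderedDet

theorem eval_detPoly (k l : ℕ) (c : (Fin (k + 1) ↪o Fin (l + 1)) → ℝ) :
    MvPolynomial.eval c (detPoly k l) =
      (Matrix.fromBlocks (Matrix.diagonal c)
        (Matrix.of fun σ ν => (incidence σ ν : ℝ))
        (Matrix.of fun σ ν => (incidence σ ν : ℝ)).transpose 0).det := by
  rw [detPoly, RingHom.map_det]
  congr 1
  ext (i | i) (j | j)
  · simp only [incidenceMatrix, RingHom.mapMatrix_apply, Matrix.map_apply,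
      Matrix.fromBlocks_apply₁₁, Matrix.diagonal_apply]
    split_ifs <;> simp
  · simp [incidenceMatrix]
  · simp [incidenceMatrix]
  · simp [incidenceMatrix]

/-- Identifies the transposed incidence matrix with the differential of the full `l`-simplex, so
that cocycles restrict to its kernel. -/
theorem sum_incidence_smul {E : Type*} [AddCommGroup E] [Module ℝ E] {k l : ℕ}
    (ν : Fin (k + 2) ↪o Fin (l + 1)) (y : (Fin (k + 1) ↪o Fin (l + 1)) → E) :
    ∑ f, (incidence f ν : ℝ) • y f =
      ∑ i : Fin (k + 2), (-1 : ℤ) ^ (i : ℕ) • y ((Fin.succAboveOrderEmb i).trans ν) := by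
  simp only [incidence, Int.cast_sum, Finset.sum_smul]
  rw [Finset.sum_comm]
  refine Finset.sum_congr rfl fun i _ => ?_
  rw [Finset.sum_eq_single ((Fin.succAboveOrderEmb i).trans ν)]
  · rw [if_pos rfl, Int.cast_smul_eq_zsmul]
  · intro f _ hf
    rw [if_neg (Ne.symm hf)]
    simp
  · simp

/-- On the cocycles of an `l`-simplex the form `∑ S_σ ‖φ(σ)‖²` is bounded below. -/
theorem le_faceSum_form {V : Type*} [DecidableEq V] {X : PreAbstractSimplicialComplex V}
    {n k l : ℕ} {ε : ℝ} (γ : OrdSimplex X l)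
    (h : ∀ x : ℝ, MvPolynomial.eval
      (fun f : Fin (k + 1) ↪o Fin (l + 1) => x - faceSum X n (γ.sub f)) (detPoly k l) = 0 → ε ≤ x)
    {H : Type*} [NormedAddCommGroup H] [InnerProductSpace ℝ H] {φ : OrdSimplex X k → H}
    (hφ : diff X ℝ H k φ = 0) :
    ε * ∑ f : Fin (k + 1) ↪o Fin (l + 1), ‖φ (γ.sub f)‖ ^ 2 ≤
      ∑ f : Fin (k + 1) ↪o Fin (l + 1), faceSum X n (γ.sub f) * ‖φ (γ.sub f)‖ ^ 2 := by
  refine le_form_of_det_of_vector (Matrix.of fun σ ν => (incidence σ ν : ℝ)) _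
    (fun x hx => h x ?_) (y := fun f => φ (γ.sub f)) fun ν => ?_
  · rw [eval_detPoly]
    exact hx
  · simp only [Matrix.of_apply]
    rw [sum_incidence_smul]
    exact congrFun hφ (γ.sub ν)

/-! ## The Laplacian of a link in terms of the ambient complex -/

section LinkLaplacian

variable {V : Type*} [DecidableEq V] {X : PreAbstractSimplicialComplex V} {n : ℕ}

theorem singleton_mem_link {t : Finset V} {v : V} :
    {v} ∈ (link X t).faces ↔ v ∉ t ∧ insert v t ∈ X.faces := by
  change ({v} : Finset V).Nonempty ∧ Disjoint {v} t ∧ {v} ∪ t ∈ X.faces ↔ _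
  rw [Finset.singleton_union]
  simp

theorem mem_link {t s : Finset V} :
    s ∈ (link X t).faces ↔ s.Nonempty ∧ Disjoint s t ∧ s ∪ t ∈ X.faces := Iff.rfl

theorem IsLocallyFinite.link (hX : IsLocallyFinite X) (t : Finset V) :
    IsLocallyFinite (link X t) := by
  intro v
  refine Set.Finite.of_finite_image (f := fun s => s ∪ t) ((hX v).subset ?_) ?_
  · rintro _ ⟨s, ⟨hs, hv⟩, rfl⟩
    exact ⟨(mem_link.1 hs).2.2, Finset.mem_union_left _ hv⟩
  · rintro s ⟨hs, -⟩ s' ⟨hs', -⟩ h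
    have h1 := Finset.union_sdiff_cancel_right (mem_link.1 hs).2.1
    have h2 := Finset.union_sdiff_cancel_right (mem_link.1 hs').2.1
    simp only at h
    rw [← h1, h, h2]

/-- Joining with `t` is a bijection from top simplices of the link containing `s` to `n`-simplices
containing `s ∪ t`. Its inverse removes `t`. -/
theorem topCount_link {t s : Finset V} (ht : t.card ≤ n) (hs : s.Nonempty)
    (hst : Disjoint s t) : topCount (link X t) (n - t.card) s = topCount X n (s ∪ t) := by
  have hinj : Set.InjOn (fun r : Finset V => r ∪ t)
      {r ∈ (link X t).faces | r.card = n - t.card + 1 ∧ s ⊆ r} := by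
    rintro r ⟨hr, -⟩ r' ⟨hr', -⟩ h
    have h1 := Finset.union_sdiff_cancel_right (mem_link.1 hr).2.1
    have h2 := Finset.union_sdiff_cancel_right (mem_link.1 hr').2.1
    simp only at h
    rw [← h1, h, h2]
  rw [topCount, ← Set.InjOn.ncard_image hinj, topCount]
  congr 1
  ext r
  simp only [Set.mem_image, Set.mem_ofPred_eq, mem_link]
  constructor
  · rintro ⟨r, ⟨⟨-, h1, h2⟩, h3, h4⟩, rfl⟩
    refine ⟨h2, ?_, Finset.union_subset_union_left h4⟩
    rw [Finset.card_union_of_disjoint h1]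
    omega
  · rintro ⟨h1, h2, h3⟩
    have h4 : t ⊆ r := Finset.subset_union_right.trans h3
    have h5 : s ⊆ r \ t :=
      Finset.subset_sdiff.2 ⟨Finset.subset_union_left.trans h3, hst⟩
    refine ⟨r \ t, ⟨⟨hs.mono h5, Finset.sdiff_disjoint, ?_⟩, ?_, h5⟩,
      Finset.sdiff_union_of_subset h4⟩
    · rwa [Finset.sdiff_union_of_subset h4]
    · rw [Finset.card_sdiff_of_subset h4]
      omega

variable (X n) in
/-- The weight of the edge `uv` in the link of `t`. -/
noncomputable def linkWeight (t : Finset V) (u v : V) : ℝ :=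
  if u = v then 0 else (topCount X n (insert u (insert v t)) : ℝ)

theorem linkWeight_comm (t : Finset V) (u v : V) :
    linkWeight X n t u v = linkWeight X n t v u := by
  unfold linkWeight
  rw [Finset.insert_comm]
  by_cases h : u = v
  · subst h; rfl
  · rw [if_neg h, if_neg (Ne.symm h)]

theorem linkWeight_nonneg (t : Finset V) (u v : V) : 0 ≤ linkWeight X n t u v := by
  unfold linkWeight
  split_ifs <;> positivity

/-- Summing over the neighbours of `u` in the link of `t`. -/
theorem sum_linkWeight_smul (hX : IsLocallyFinite X) {t : Finset V} (ht : t.Nonempty) (u : V)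
    {E : Type*} [AddCommGroup E] [Module ℝ E] (F : V → E) :
    ∑ v ∈ linkFinset X (insert u t), (topCount X n (insert v (insert u t)) : ℝ) • F v =
      ∑ v ∈ linkFinset X t, linkWeight X n t u v • F v := by
  have hsub : linkFinset X (insert u t) ⊆ linkFinset X t := by
    intro v hv
    rw [mem_linkFinset hX (Finset.insert_nonempty u t)] at hv
    rw [mem_linkFinset hX ht]
    refine ⟨fun h => hv.1 (Finset.mem_insert_of_mem h), ?_⟩
    exact (X.isRelLowerSet_faces hv.2).2 (Finset.insert_subset_insert _ (Finset.subset_insert _ _))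
      (Finset.insert_nonempty _ _)
  rw [← Finset.sum_subset hsub]
  · refine Finset.sum_congr rfl fun v hv => ?_
    rw [mem_linkFinset hX (Finset.insert_nonempty u t)] at hv
    have : u ≠ v := fun h => hv.1 (h ▸ Finset.mem_insert_self _ _)
    rw [linkWeight, if_neg this, Finset.insert_comm]
  · intro v hv hv'
    rw [mem_linkFinset hX (Finset.insert_nonempty u t)] at hv'
    rw [mem_linkFinset hX ht] at hv
    rw [linkWeight]
    split_ifs with h
    · simp
    · rw [topCount_eq_zero]
      · simp
      · rw [Finset.insert_comm]
        refine fun h' => hv' ⟨?_, h'⟩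
        simp [Ne.symm h, hv.1]
      · exact Finset.insert_nonempty _ _

variable (X n) in
/-- The positive eigenvalues of the Laplacian of the link of `t`. -/
def IsLinkEigenvalue (t : Finset V) (x : ℝ) : Prop :=
  0 < x ∧ ∃ f : linkFinset X t → ℝ, f ≠ 0 ∧
    ∀ u : linkFinset X t, ∑ v : linkFinset X t, linkWeight X n t u v * (f u - f v) =
      x * ((topCount X n (insert u.1 t) : ℝ) * f u)

/-- The ordered simplex consisting of a single vertex. -/
def OrdSimplex.ofVertex {K : PreAbstractSimplicialComplex V} (v : V) (hv : {v} ∈ K.faces) :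
    OrdSimplex K 0 :=
  ⟨⟨fun _ => v, fun _ _ _ => Subsingleton.elim (α := Fin 1) _ _⟩, by
    convert hv using 1
    ext w
    simp only [Finset.mem_map, Finset.mem_univ, true_and, Finset.mem_singleton]
    exact ⟨fun ⟨_, h⟩ => h.symm, fun h => ⟨0, h.symm⟩⟩⟩

@[simp] theorem OrdSimplex.ofVertex_apply {K : PreAbstractSimplicialComplex V} (v : V)
    (hv : {v} ∈ K.faces) (i) : (ofVertex v hv).1 i = v := rfl

theorem OrdSimplex.singleton_mem {K : PreAbstractSimplicialComplex V} (σ : OrdSimplex K 0) :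
    {σ.1 0} ∈ K.faces :=
  (K.isRelLowerSet_faces σ.vertices_mem).2
    (Finset.singleton_subset_iff.2 (σ.apply_mem_vertices 0)) (Finset.singleton_nonempty _)

theorem OrdSimplex.eq_ofVertex {K : PreAbstractSimplicialComplex V} (σ : OrdSimplex K 0) (u : V)
    (h : σ.1 0 = u) : σ = ofVertex u (h ▸ σ.singleton_mem) :=
  ext' fun i => by
    subst h
    exact congrArg σ.1 (Subsingleton.elim (α := Fin 1) i 0)

theorem OrdSimplex.vertices_ofVertex {K : PreAbstractSimplicialComplex V} (v : V)
    (hv : {v} ∈ K.faces) : (ofVertex v hv).vertices = {v} := by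
  ext w
  simp [mem_vertices, eq_comm]

theorem upLaplacian_ofVertex {K : PreAbstractSimplicialComplex V} (hK : IsLocallyFinite K)
    (d : ℕ) (F : V → ℝ) (φ : OrdSimplex K 0 → ℝ) (hφ : ∀ v hv, φ (OrdSimplex.ofVertex v hv) = F v)
    (u : V) (hu : {u} ∈ K.faces) :
    upLaplacian K d φ (OrdSimplex.ofVertex u hu) =
      ∑ v ∈ linkFinset K {u}, (topCount K d {v, u} : ℝ) / (topCount K d {u} : ℝ) * (F u - F v) := by
  unfold upLaplacian codiff
  -- By local finiteness the index set is the finite set `coface`, so the `finsum` is a genuine sum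
  -- and not the default value `0`.
  rw [finsum_subtype_eq_finsum_cond (f := fun σ : OrdSimplex K 1 =>
    (topCount K d σ.vertices : ℝ) / (topCount K d (OrdSimplex.ofVertex u hu).vertices : ℝ) *
      diff K ℝ ℝ 0 φ σ) (p := fun σ => σ.face 0 = OrdSimplex.ofVertex u hu)]
  simp only [← mem_coface hK]
  rw [finsum_mem_finset_eq_sum, sum_coface]
  simp only [OrdSimplex.vertices_cons, OrdSimplex.vertices_ofVertex]
  rw [← OrdSimplex.vertices_ofVertex u hu]
  refine Eq.trans ?_ (Finset.sum_coe_sort _ _)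
  refine Finset.sum_congr rfl fun v _ => ?_
  congr 1
  rw [diff_apply, Fin.sum_univ_two, OrdSimplex.cons_face_zero, hφ,
    OrdSimplex.eq_ofVertex (((OrdSimplex.ofVertex u hu).cons v).face 1) v.1 rfl, hφ]
  simp
  ring

open Classical in
-- Multiplying the Laplacian of the link at `u` by `m(ut) > 0` turns it into the weighted graph
-- Laplacian with symmetric edge weights `m(uvt)`, to which the graph inequalities apply.
theorem isLinkEigenvalue_iff (hX : IsLocallyFinite X)
    (hX_pure : ∀ s ∈ X.faces, 1 ≤ topCount X n s) {t : Finset V} (ht : t.Nonempty)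
    (htn : t.card ≤ n) (x : ℝ) :
    IsLinkEigenvalue X n t x ↔
      0 < x ∧ ∃ φ : OrdSimplex (link X t) 0 → ℝ, φ ≠ 0 ∧
        upLaplacian (link X t) (n - t.card) φ = x • φ := by
  have hL : ∀ v, v ∈ linkFinset X t ↔ {v} ∈ (link X t).faces := fun v => by
    rw [mem_linkFinset hX ht, singleton_mem_link]
  have key : ∀ (F : V → ℝ) (φ : OrdSimplex (link X t) 0 → ℝ),
      (∀ v hv, φ (OrdSimplex.ofVertex v hv) = F v) → ∀ (u : V) (hu : {u} ∈ (link X t).faces),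
      (topCount X n (insert u t) : ℝ) *
        upLaplacian (link X t) (n - t.card) φ (OrdSimplex.ofVertex u hu) =
      ∑ v ∈ linkFinset X t, linkWeight X n t u v * (F u - F v) := by
    intro F φ hφ u hu
    have hu' := singleton_mem_link.1 hu
    have hpos : (topCount X n (insert u t) : ℝ) ≠ 0 := by
      have := hX_pure _ hu'.2
      positivity
    rw [upLaplacian_ofVertex (hX.link t) _ F φ hφ u hu, Finset.mul_sum]
    have h1 := sum_linkWeight_smul (n := n) hX ht u fun v => F u - F v
    simp only [smul_eq_mul] at h1
    rw [← h1]
    have h2 : linkFinset (link X t) {u} = linkFinset X (insert u t) := by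
      ext v
      rw [mem_linkFinset (hX.link t) (Finset.singleton_nonempty u),
        mem_linkFinset hX (Finset.insert_nonempty u t), mem_link]
      simp only [Finset.insert_union, Finset.singleton_union, Finset.insert_nonempty,
        Finset.disjoint_insert_left, Finset.disjoint_singleton_left, Finset.mem_insert,
        Finset.mem_singleton]
      tauto
    rw [h2]
    refine Finset.sum_congr rfl fun v hv => ?_
    have hv' := (mem_linkFinset hX (Finset.insert_nonempty u t)).1 hv
    rw [topCount_link htn (Finset.singleton_nonempty _)
      (Finset.disjoint_singleton_left.2 hu'.1), topCount_link htn (Finset.insert_nonempty _ _)]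
    · simp only [Finset.insert_union, Finset.singleton_union]
      field_simp
    · rw [Finset.disjoint_insert_left, Finset.disjoint_singleton_left]
      exact ⟨fun h => hv'.1 (Finset.mem_insert_of_mem h), hu'.1⟩
  refine and_congr_right fun _ => ⟨?_, ?_⟩
  · rintro ⟨f, hf, hfx⟩
    let F : V → ℝ := fun v => if h : v ∈ linkFinset X t then f ⟨v, h⟩ else 0
    have hF : ∀ u : linkFinset X t, F u = f u := fun u => by simp [F]
    let φ : OrdSimplex (link X t) 0 → ℝ := fun σ => F (σ.1 0)
    refine ⟨φ, fun h => hf ?_, ?_⟩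
    · funext u
      have := congrFun h (OrdSimplex.ofVertex u.1 ((hL _).1 u.2))
      rw [← hF]
      exact this
    · funext σ
      rw [OrdSimplex.eq_ofVertex σ _ rfl]
      have h1 := key F φ (fun _ _ => rfl) (σ.1 0) σ.singleton_mem
      have h2 := hfx ⟨σ.1 0, (hL _).2 σ.singleton_mem⟩
      simp only [← hF] at h2
      rw [Finset.sum_coe_sort (linkFinset X t) fun v =>
        linkWeight X n t (σ.1 0) v * (F (σ.1 0) - F v), ← h1] at h2
      have hpos : (topCount X n (insert (σ.1 0) t) : ℝ) ≠ 0 := by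
        have := hX_pure _ (singleton_mem_link.1 σ.singleton_mem).2
        positivity
      apply mul_left_cancel₀ hpos
      rw [h2]
      simp only [Pi.smul_apply, smul_eq_mul, φ, OrdSimplex.ofVertex_apply]
      ring
  · rintro ⟨φ, hφ, hφx⟩
    let F : V → ℝ := fun v => if h : {v} ∈ (link X t).faces then φ (.ofVertex v h) else 0
    have hF : ∀ v hv, φ (.ofVertex v hv) = F v := fun v hv => by simp [F, hv]
    refine ⟨fun u => F u, fun h => hφ ?_, fun u => ?_⟩
    · funext σ
      rw [OrdSimplex.eq_ofVertex σ _ rfl, hF]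
      exact congrFun h ⟨σ.1 0, (hL _).2 σ.singleton_mem⟩
    · rw [Finset.sum_coe_sort (linkFinset X t) fun v => linkWeight X n t u v * (F u - F v),
        ← key F φ hF u.1 ((hL _).1 u.2), hφx]
      simp only [Pi.smul_apply, smul_eq_mul, hF]
      ring

theorem smallestPosEigenvalue_link (hX : IsLocallyFinite X)
    (hX_pure : ∀ s ∈ X.faces, 1 ≤ topCount X n s) {t : Finset V} (ht : t.Nonempty)
    (htn : t.card ≤ n) :
    smallestPosEigenvalue (link X t) (n - t.card) = sInf {x | IsLinkEigenvalue X n t x} := by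
  unfold smallestPosEigenvalue
  congr 1
  ext x
  exact (isLinkEigenvalue_iff hX hX_pure ht htn x).symm

theorem smallestPosEigenvalue_nonneg (K : PreAbstractSimplicialComplex V) (d : ℕ) :
    0 ≤ smallestPosEigenvalue K d :=
  Real.sInf_nonneg fun _ hx => hx.1.le

/-- Each `n`-simplex containing `u` and `t` has `n - |t|` further vertices. The diagonal weight must
be `0` here, since inserting `u` twice would otherwise contribute `m(ut)` again. -/
theorem sum_linkWeight (hX : IsLocallyFinite X) {t : Finset V} (ht : t.Nonempty)
    (htn : t.card ≤ n) {u : V} (hu : u ∈ linkFinset X t) :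
    ∑ v ∈ linkFinset X t, linkWeight X n t u v = (n - t.card) * topCount X n (insert u t) := by
  have h1 := sum_linkWeight_smul (n := n) hX ht u fun _ => (1 : ℝ)
  simp only [smul_eq_mul, mul_one] at h1
  have h2 := sum_topCount_insert (n := n) hX (Finset.insert_nonempty u t)
  rw [Finset.card_insert_of_notMem (prop_of_mem_linkFinset hu).1] at h2
  rw [← h1, ← Nat.cast_sum, h2, Nat.add_sub_add_right]
  push_cast [Nat.cast_sub htn]
  ring

/-- Eigenvalues of the Laplacian are at most twice the dimension. -/
theorem smallestPosEigenvalue_le (hX : IsLocallyFinite X)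
    (hX_pure : ∀ s ∈ X.faces, 1 ≤ topCount X n s) {t : Finset V} (ht : t.Nonempty)
    (htn : t.card ≤ n) :
    smallestPosEigenvalue (link X t) (n - t.card) ≤ 2 * n := by
  rw [smallestPosEigenvalue_link hX hX_pure ht htn]
  rcases Set.eq_empty_or_nonempty {x | IsLinkEigenvalue X n t x} with h | ⟨x, hx⟩
  · rw [h, Real.sInf_empty]
    positivity
  refine (csInf_le ⟨0, fun y hy => hy.1.le⟩ hx).trans ?_
  obtain ⟨-, f, hf, hfx⟩ := hx
  let a : linkFinset X t → linkFinset X t → ℝ := fun u v => linkWeight X n t u v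
  have ha : ∀ u v, a u v = a v u := fun u v => linkWeight_comm t u.1 v.1
  have h1 := sum_mul_laplacian a ha f
  have hfx' : ∀ u, ∑ v, a u v * (f u - f v) = x * ((topCount X n (insert u.1 t) : ℝ) * f u) := hfx
  simp only [hfx'] at h1
  have h2 : ∑ u, f u * (x * ((topCount X n (insert u.1 t) : ℝ) * f u)) =
      x * ∑ u, (topCount X n (insert u.1 t) : ℝ) * f u ^ 2 := by
    rw [Finset.mul_sum]
    exact Finset.sum_congr rfl fun u _ => by ring
  -- The bound comes from `(p - q)² ≤ 2p² + 2q²` and the weighted vertex degree, which is `n - |t|`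
  -- times the vertex weight.
  have h3 : ∑ u, ∑ v, a u v * (f u - f v) ^ 2 ≤
      ∑ u, ∑ v, 2 * (a u v * f u ^ 2) + ∑ u, ∑ v, 2 * (a u v * f v ^ 2) := by
    rw [← Finset.sum_add_distrib]
    refine Finset.sum_le_sum fun u _ => ?_
    rw [← Finset.sum_add_distrib]
    refine Finset.sum_le_sum fun v _ => ?_
    have h4 : 0 ≤ a u v * (f u + f v) ^ 2 := mul_nonneg (linkWeight_nonneg _ _ _) (sq_nonneg _)
    linarith
  have h4 : ∑ u, ∑ v, 2 * (a u v * f v ^ 2) = ∑ u, ∑ v, 2 * (a u v * f u ^ 2) := by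
    rw [Finset.sum_comm]
    exact Finset.sum_congr rfl fun u _ => Finset.sum_congr rfl fun v _ => by rw [ha]
  have h5 : ∑ u, ∑ v, 2 * (a u v * f u ^ 2) =
      2 * (n - t.card) * ∑ u, (topCount X n (insert u.1 t) : ℝ) * f u ^ 2 := by
    rw [Finset.mul_sum]
    refine Finset.sum_congr rfl fun u _ => ?_
    rw [← Finset.mul_sum, ← Finset.sum_mul, Finset.sum_coe_sort (linkFinset X t) fun v =>
      linkWeight X n t u.1 v, sum_linkWeight hX ht htn u.2]
    ring
  obtain ⟨u₀, hu₀⟩ := Function.ne_iff.1 hf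
  have hu₀' : f u₀ ≠ 0 := hu₀
  have hb : ∀ u : linkFinset X t, (0 : ℝ) < topCount X n (insert u.1 t) := fun u => by
    have := hX_pure _ (prop_of_mem_linkFinset u.2).2
    positivity
  have h6 : 0 < ∑ u, (topCount X n (insert u.1 t) : ℝ) * f u ^ 2 :=
    Finset.sum_pos' (fun u _ => mul_nonneg (hb u).le (sq_nonneg _))
      ⟨u₀, Finset.mem_univ _, mul_pos (hb u₀) (sq_pos_of_ne_zero hu₀')⟩
  have h7 : x * ∑ u, (topCount X n (insert u.1 t) : ℝ) * f u ^ 2 ≤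
      2 * (n - t.card) * ∑ u, (topCount X n (insert u.1 t) : ℝ) * f u ^ 2 := by
    linarith
  have h8 := le_of_mul_le_mul_right h7 h6
  have h9 : (0 : ℝ) ≤ t.card := by positivity
  linarith

/-- The Poincaré inequality on the link of `t`. -/
theorem link_poincare (hX : IsLocallyFinite X)
    (hX_pure : ∀ s ∈ X.faces, 1 ≤ topCount X n s) (hX_links : HasConnectedLinks X n)
    {t : Finset V} (htX : t ∈ X.faces) (htn : t.card < n)
    {H : Type*} [NormedAddCommGroup H] [InnerProductSpace ℝ H] (f : linkFinset X t → H) :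
    smallestPosEigenvalue (link X t) (n - t.card) *
      (∑ u, (topCount X n (insert u.1 t) : ℝ) * ‖f u‖ ^ 2 -
        ‖∑ u, (topCount X n (insert u.1 t) : ℝ) • f u‖ ^ 2 /
          ((n + 1 - t.card) * topCount X n t)) ≤
      1 / 2 * ∑ u : linkFinset X t, ∑ v : linkFinset X t,
        linkWeight X n t u v * ‖f u - f v‖ ^ 2 := by
  have ht : t.Nonempty := (X.isRelLowerSet_faces htX).1
  have hsum : ∑ u : linkFinset X t, (topCount X n (insert u.1 t) : ℝ) =
      (n + 1 - t.card) * topCount X n t := by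
    rw [Finset.sum_coe_sort (linkFinset X t) fun u => (topCount X n (insert u t) : ℝ),
      ← Nat.cast_sum, sum_topCount_insert hX ht]
    push_cast [Nat.cast_sub (show t.card ≤ n + 1 by omega)]
    ring
  rw [← hsum]
  refine poincare (fun u v => linkWeight X n t u.1 v.1) (fun u v => linkWeight_comm t u.1 v.1)
    (fun u v => linkWeight_nonneg t u.1 v.1) (fun u => ?_) ?_ ?_ f
  · have := hX_pure _ (prop_of_mem_linkFinset u.2).2
    positivity
  · intro f hf u v
    have hL : ∀ v, {v} ∈ (link X t).faces → v ∈ linkFinset X t := fun v hv => by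
      rwa [mem_linkFinset hX ht, ← singleton_mem_link]
    have hreach := (hX_links t htX htn).preconnected
      ⟨u.1, singleton_mem_link.2 (prop_of_mem_linkFinset u.2)⟩
      ⟨v.1, singleton_mem_link.2 (prop_of_mem_linkFinset v.2)⟩
    -- An edge of the link spans a face together with `t`. By purity this face lies in an
    -- `n`-simplex, so the edge has positive weight and connectedness of the link yields `hconn`.
    have hwalk : ∀ u v : {v : V // {v} ∈ (link X t).faces},
        (skeletonGraph (link X t)).Walk u v → f ⟨u.1, hL _ u.2⟩ = f ⟨v.1, hL _ v.2⟩ := by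
      intro u v p
      induction p with
      | nil => rfl
      | @cons u v w huv p ih =>
        rw [← ih]
        refine hf _ _ ?_
        have h1 : u ≠ v := huv.1
        have h2 : ({u.1, v.1} : Finset V) ∪ t ∈ X.faces := (mem_link.1 huv.2).2.2
        simp only [linkWeight]
        rw [if_neg (fun h => h1 (Subtype.ext h))]
        simp only [Finset.insert_union, Finset.singleton_union] at h2
        have := hX_pure _ h2
        positivity
    exact hreach.elim fun p => hwalk _ _ p
  · intro x hx f hf hfx
    rw [smallestPosEigenvalue_link hX hX_pure ht htn.le]
    exact csInf_le ⟨0, fun y hy => hy.1.le⟩ ⟨hx, f, hf, hfx⟩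

end LinkLaplacian

/-! ### Link eigenvalues are constant on orbits -/

section Invariance

variable {V : Type*} [DecidableEq V] {Γ : Type*} [Group Γ] [MulAction Γ V]
  {X : PreAbstractSimplicialComplex V} [IsSimplicialAction Γ X] {n : ℕ}

theorem linkWeight_smul (g : Γ) (t : Finset V) (u v : V) :
    linkWeight X n (g • t) (g • u) (g • v) = linkWeight X n t u v := by
  simp only [linkWeight, ← Finset.smul_finset_insert, topCount_smul, smul_left_cancel_iff]

theorem IsLinkEigenvalue.smul (hX : IsLocallyFinite X) {t : Finset V} (ht : t.Nonempty) (g : Γ)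
    {x : ℝ} (h : IsLinkEigenvalue X n t x) : IsLinkEigenvalue X n (g • t) x := by
  obtain ⟨hx, f, hf, hfx⟩ := h
  let e : linkFinset X t ≃ linkFinset X (g • t) :=
    (MulAction.toPerm g).subtypeEquiv fun v => (mem_linkFinset_smul hX g ht v).symm
  have he : ∀ u, (e u).1 = g • u.1 := fun _ => rfl
  refine ⟨hx, fun u => f (e.symm u), fun h => hf ?_, fun u => ?_⟩
  · funext u
    have := congrFun h (e u)
    simpa using this
  · obtain ⟨u, rfl⟩ := e.surjective u
    rw [← e.sum_comp]
    simp only [Equiv.symm_apply_apply, he, linkWeight_smul, ← Finset.smul_finset_insert,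
      topCount_smul]
    exact hfx u

/-- Translation by `g` is an isomorphism of links preserving all weights, so it transports
eigenfunctions. The inverse translation gives the other inclusion. -/
theorem shiftedEigenvalue_smul (hX : IsLocallyFinite X)
    (hX_pure : ∀ s ∈ X.faces, 1 ≤ topCount X n s) {t : Finset V} (ht : t.Nonempty)
    (htn : t.card ≤ n) (g : Γ) :
    shiftedEigenvalue X n t.card (g • t) = shiftedEigenvalue X n t.card t := by
  have h1 := smallestPosEigenvalue_link hX hX_pure ht htn
  have h2 := smallestPosEigenvalue_link hX hX_pure (t := g • t) ht.smul_finset (by simpa using htn)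
  rw [Finset.card_smul_finset] at h2
  rw [shiftedEigenvalue, shiftedEigenvalue, h1, h2]
  congr 3
  ext x
  refine ⟨fun h => ?_, fun h => h.smul hX ht g⟩
  have := h.smul hX ht.smul_finset g⁻¹
  rwa [inv_smul_smul] at this

end Invariance

/-! ## Orbit sums over ordered simplices -/

section SimplexSums

variable {V : Type*} [DecidableEq V] {X : PreAbstractSimplicialComplex V} {n : ℕ}

variable (n) in
/-- The number of `n`-simplices containing `σ`, as a real number. -/
noncomputable def mult {k : ℕ} (σ : OrdSimplex X k) : ℝ := topCount X n σ.vertices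

theorem mult_nonneg {k : ℕ} (σ : OrdSimplex X k) : 0 ≤ mult n σ := Nat.cast_nonneg _

theorem mult_pos (hX_pure : ∀ s ∈ X.faces, 1 ≤ topCount X n s) {k : ℕ} (σ : OrdSimplex X k) :
    0 < mult n σ :=
  Nat.cast_pos.2 (hX_pure _ σ.vertices_mem)

@[simp] theorem mult_perm {k : ℕ} (σ : OrdSimplex X k) (π) : mult n (σ.perm π) = mult n σ := by
  simp [mult]

theorem sum_mult_coface (hX : IsLocallyFinite X) {k : ℕ} (hk : k ≤ n) (τ : OrdSimplex X k) :
    ∑ σ ∈ coface τ, mult n σ = (n - k) * mult n τ := by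
  rw [sum_coface]
  simp only [mult, OrdSimplex.vertices_cons]
  rw [Finset.sum_coe_sort (linkFinset X τ.vertices) fun v =>
    (topCount X n (insert v τ.vertices) : ℝ), ← Nat.cast_sum,
    sum_topCount_insert hX τ.vertices_nonempty, OrdSimplex.card_vertices, Nat.add_sub_add_right]
  push_cast [Nat.cast_sub hk]
  ring

section Action

variable {Γ : Type*} [Group Γ] [MulAction Γ V] [IsSimplicialAction Γ X]

theorem mult_invariant (k : ℕ) : IsOrbitInvariant Γ (mult n : OrdSimplex X k → ℝ) := by
  intro g σ
  rw [mult, vertices_smul, topCount_smul, mult]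

theorem IsOrbitInvariant.mul {A : Type*} [MulAction Γ A] {f g : A → ℝ}
    (hf : IsOrbitInvariant Γ f) (hg : IsOrbitInvariant Γ g) :
    IsOrbitInvariant Γ fun a => f a * g a :=
  fun x a => by beta_reduce; rw [hf, hg]

theorem IsOrbitInvariant.face {k : ℕ} {f : OrdSimplex X k → ℝ} (hf : IsOrbitInvariant Γ f)
    (i) : IsOrbitInvariant Γ fun σ : OrdSimplex X (k + 1) => f (σ.face i) :=
  fun g σ => by beta_reduce; rw [smul_face, hf]

theorem IsOrbitInvariant.reindex {k l : ℕ} {f : OrdSimplex X k → ℝ} (hf : IsOrbitInvariant Γ f)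
    (e : Fin (k + 1) ↪ Fin (l + 1)) :
    IsOrbitInvariant Γ fun σ : OrdSimplex X l => f (σ.reindex e) :=
  fun g σ => by beta_reduce; rw [smul_reindex, hf]

variable [TopologicalSpace Γ] [IsTopologicalGroup Γ] [MeasurableSpace Γ] [BorelSpace Γ]
  (μ : Measure Γ) [μ.IsHaarMeasure] [μ.IsMulRightInvariant]
  (hX : IsLocallyFinite X) (hΓ : IsProperAction Γ X)
  {R : ∀ j : ℕ, Set (OrdSimplex X j)} (hR : ∀ j : ℕ, IsOrbitTransversal Γ (R j))

include hΓ hR in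
-- Reordering is an equivariant bijection, so this is `HasOrbitSum.fiberSum` with one-point fibres.
-- The permuted simplices need not lie in `R k`; only their orbits matter.
theorem HasOrbitSum.perm {k : ℕ} {f : OrdSimplex X k → ℝ} (hf : IsOrbitInvariant Γ f) {s : ℝ}
    (h : HasOrbitSum μ (R k) f s) (π : Equiv.Perm (Fin (k + 1))) :
    HasOrbitSum μ (R k) (fun σ => f (σ.perm π)) s := by
  have hc := hasCompactOpenStabilizers hΓ k
  have := h.fiberSum μ hc hc (hR k) (hR k) (fun σ => σ.perm π⁻¹) (fun g σ => smul_perm g σ π⁻¹)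
    (fun σ => {σ.perm π}) (fun x b => by
      rw [Finset.mem_singleton]
      constructor
      · rintro rfl
        rw [OrdSimplex.perm_perm, mul_inv_cancel]
        rfl
      · rintro rfl
        rw [OrdSimplex.perm_perm, inv_mul_cancel]
        rfl) hf
  simpa using this

include hX hΓ hR in
theorem HasOrbitSum.coface {k : ℕ} {f : OrdSimplex X (k + 1) → ℝ} (hf : IsOrbitInvariant Γ f)
    {s : ℝ} (h : HasOrbitSum μ (R (k + 1)) f s) :
    HasOrbitSum μ (R k) (fun τ => ∑ σ ∈ coface τ, f σ) s :=
  h.fiberSum μ (hasCompactOpenStabilizers hΓ _) (hasCompactOpenStabilizers hΓ _) (hR _) (hR _)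
    (fun σ => σ.face 0) (fun g σ => smul_face g σ 0) _ (mem_coface hX) hf

theorem HasOrbitSum.summable {A : Type*} [MulAction Γ A] {S : Set A} {f : A → ℝ} {s : ℝ}
    (h : HasOrbitSum μ S f s) : OrbitSummable μ S f := HasSum.summable h

theorem OrbitSummable.exists_hasOrbitSum {A : Type*} [MulAction Γ A] {S : Set A} {f : A → ℝ}
    (h : OrbitSummable μ S f) : ∃ s, HasOrbitSum μ S f s := ⟨_, Summable.hasSum h⟩

theorem OrbitSummable.of_abs_le {A : Type*} [MulAction Γ A] {S : Set A} {f g : A → ℝ}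
    (h : OrbitSummable μ S g) (hfg : ∀ a, |f a| ≤ g a) : OrbitSummable μ S f := by
  refine Summable.of_norm_bounded h fun a => ?_
  rw [Real.norm_eq_abs, abs_div, abs_of_nonneg (a := stabVol μ a.1) measureReal_nonneg]
  exact div_le_div_of_nonneg_right (hfg a) measureReal_nonneg

theorem OrbitSummable.abs {A : Type*} [MulAction Γ A] {S : Set A} {f : A → ℝ}
    (h : OrbitSummable μ S f) : OrbitSummable μ S fun a => |f a| := by
  refine (Summable.abs h).congr fun a => ?_
  rw [abs_div, abs_of_nonneg (a := stabVol μ a.1) measureReal_nonneg]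

theorem HasOrbitSum.add {A : Type*} [MulAction Γ A] {S : Set A} {f g : A → ℝ} {s t : ℝ}
    (hf : HasOrbitSum μ S f s) (hg : HasOrbitSum μ S g t) :
    HasOrbitSum μ S (fun a => f a + g a) (s + t) := by
  have := HasSum.add hf hg
  simp only [← add_div] at this
  exact this

theorem HasOrbitSum.const_mul {A : Type*} [MulAction Γ A] {S : Set A} {f : A → ℝ} {s : ℝ} (c : ℝ)
    (hf : HasOrbitSum μ S f s) : HasOrbitSum μ S (fun a => c * f a) (c * s) := by
  have := HasSum.mul_left c hf
  simp only [← mul_div_assoc] at this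
  exact this

theorem HasOrbitSum.sum {A ι : Type*} [MulAction Γ A] [Fintype ι] {S : Set A} {f : ι → A → ℝ}
    {s : ι → ℝ} (hf : ∀ i, HasOrbitSum μ S (f i) (s i)) :
    HasOrbitSum μ S (fun a => ∑ i, f i a) (∑ i, s i) := by
  have := hasSum_sum (s := Finset.univ) fun i _ => hf i
  simp only [← Finset.sum_div] at this
  exact this

theorem HasOrbitSum.mono {A : Type*} [MulAction Γ A] {S : Set A} {f g : A → ℝ} {s t : ℝ}
    (hf : HasOrbitSum μ S f s) (hg : HasOrbitSum μ S g t) (h : ∀ a ∈ S, f a ≤ g a) : s ≤ t :=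
  hasSum_le (fun a : S => div_le_div_of_nonneg_right (h _ a.2) measureReal_nonneg) hf hg

theorem HasOrbitSum.unique {A : Type*} [MulAction Γ A] {S : Set A} {f : A → ℝ} {s t : ℝ}
    (hf : HasOrbitSum μ S f s) (hg : HasOrbitSum μ S f t) : s = t :=
  HasSum.unique hf hg

include hX hΓ hR in
-- The simplices `vτ` have total multiplicity `(n - k) m(τ)`. Fibre summation presupposes
-- convergence upstairs, so summability is first proved for `|f|`.
theorem HasOrbitSum.face_zero {k : ℕ} (hk : k ≤ n) {f : OrdSimplex X k → ℝ}
    (hf : IsOrbitInvariant Γ f) {s : ℝ} (h : HasOrbitSum μ (R k) (fun τ => mult n τ * f τ) s) :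
    HasOrbitSum μ (R (k + 1)) (fun σ => mult n σ * f (σ.face 0)) ((n - k) * s) := by
  have hsum : ∀ (F : OrdSimplex X k → ℝ) (τ : OrdSimplex X k),
      ∑ σ ∈ LinkCriterion.coface τ, mult n σ * F (σ.face 0) = (n - k) * (mult n τ * F τ) := by
    intro F τ
    rw [← mul_assoc, ← sum_mult_coface hX hk, Finset.sum_mul]
    refine Finset.sum_congr rfl fun σ hσ => ?_
    rw [(mem_coface hX σ τ).1 hσ]
  have h1 : OrbitSummable μ (R (k + 1)) fun σ => mult n σ * |f (σ.face 0)| := by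
    refine OrbitSummable.of_fiberSum μ (hasCompactOpenStabilizers hΓ _)
      (hasCompactOpenStabilizers hΓ _) (hR _) (hR k) (fun σ => σ.face 0)
      (fun g σ => smul_face g σ 0) _ (mem_coface hX) ?_ ?_ ?_
    · exact (mult_invariant _).mul fun g σ => by rw [smul_face, hf]
    · exact fun σ => mul_nonneg (mult_nonneg σ) (abs_nonneg _)
    · have h2 : (fun τ => ∑ σ ∈ LinkCriterion.coface τ, mult n σ * |f (σ.face 0)|) =
          fun τ => (n - k) * |mult n τ * f τ| := by
        funext τ
        rw [hsum fun τ => |f τ|, abs_mul, abs_of_nonneg (mult_nonneg τ)]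
      rw [h2]
      obtain ⟨t, ht⟩ := (h.summable μ).abs μ |>.exists_hasOrbitSum μ
      exact (ht.const_mul μ _).summable μ
  obtain ⟨t, ht⟩ := (h1.of_abs_le μ (f := fun σ => mult n σ * f (σ.face 0)) fun σ => by
    rw [abs_mul, abs_of_nonneg (mult_nonneg σ)]).exists_hasOrbitSum μ
  have h2 := ht.coface μ hX hΓ hR ((mult_invariant _).mul (hf.face 0))
  simp only [hsum] at h2
  rwa [(h.const_mul μ _).unique μ h2]

include hX hΓ hR in
theorem HasOrbitSum.face {k : ℕ} (hk : k ≤ n) {f : OrdSimplex X k → ℝ}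
    (hf : IsOrbitInvariant Γ f) {s : ℝ} (h : HasOrbitSum μ (R k) (fun τ => mult n τ * f τ) s)
    (i : Fin (k + 2)) :
    HasOrbitSum μ (R (k + 1)) (fun σ => mult n σ * f (σ.face i)) ((n - k) * s) := by
  induction i using Fin.induction with
  | zero => exact h.face_zero μ hX hΓ hR hk hf
  | succ i ih =>
    have := ih.perm μ hΓ hR ((mult_invariant _).mul (hf.face _))
      (Equiv.swap i.castSucc i.succ)
    simpa only [mult_perm, OrdSimplex.face_castSucc_perm_swap] using this

include hX hΓ hR in
/-- The `l`-simplices having a given `k`-simplex as the face in a given position number a fixed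
positive multiple of the `n`-simplices containing it, when weighted by multiplicity. -/
theorem exists_reindex_const (k l : ℕ) (hkl : k ≤ l) (hl : l ≤ n) :
    ∃ c : ℝ, 0 < c ∧ ∀ (e : Fin (k + 1) ↪ Fin (l + 1)) (f : OrdSimplex X k → ℝ),
      IsOrbitInvariant Γ f → ∀ s : ℝ, HasOrbitSum μ (R k) (fun τ => mult n τ * f τ) s →
        HasOrbitSum μ (R l) (fun γ => mult n γ * f (γ.reindex e)) (c * s) := by
  induction l, hkl using Nat.le_induction with
  | base =>
    refine ⟨1, one_pos, fun e f hf s h => ?_⟩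
    have := h.perm μ hΓ hR ((mult_invariant _).mul hf)
      (Equiv.ofBijective e (Finite.injective_iff_bijective.1 e.injective))
    simp only [mult_perm] at this
    rw [one_mul]
    exact this
  | succ l hkl ih =>
    obtain ⟨c, hc, ih⟩ := ih (by omega)
    have hnl : (0 : ℝ) < n - l := by
      rw [sub_pos, Nat.cast_lt]
      omega
    refine ⟨(n - l) * c, mul_pos hnl hc, fun e f hf s h => ?_⟩
    -- As `k < l + 1`, some position `i` is missed by `e`. Moving it to the front factors `e`
    -- through the face omitting vertex `0`. Hence the constant is independent of `e`.
    obtain ⟨i, hi⟩ : ∃ i, ∀ x, e x ≠ i := by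
      by_contra! hcon
      have := Fintype.card_le_of_surjective e hcon
      simp at this
      omega
    let π := Equiv.swap 0 i
    have he : ∀ x, ∃ y, Fin.succ y = π (e x) := fun x => by
      refine Fin.exists_succ_eq.2 fun h0 => hi x ?_
      have := congrArg π h0
      simpa [π] using this
    choose e' he' using he
    have hinj : Function.Injective e' := fun x y hxy => by
      have := (he' x).symm.trans ((congrArg Fin.succ hxy).trans (he' y))
      exact e.injective (π.injective this)
    have h1 := ((ih ⟨e', hinj⟩ f hf s h).face_zero μ hX hΓ hR (by omega) (hf.reindex _)).perm
      μ hΓ hR ((mult_invariant _).mul ((hf.reindex _).face 0)) π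
    have h2 : ∀ γ : OrdSimplex X (l + 1),
        ((γ.perm π).face 0).reindex ⟨e', hinj⟩ = γ.reindex e := fun γ => by
      refine OrdSimplex.ext' fun x => ?_
      simp [he', π]
    simp only [h2, mult_perm] at h1
    rwa [mul_assoc]

end Action

end SimplexSums

/-! ### Garland's method: localization to links and the lower bound for the codifferential -/

section Garland

attribute [local instance] InnerProductSpace.complexToReal

variable {V : Type*} [DecidableEq V] {X : PreAbstractSimplicialComplex V} {n : ℕ}
  {Γ : Type*} [Group Γ] [MulAction Γ V] [IsSimplicialAction Γ X]
  {H : Type*} [NormedAddCommGroup H] [InnerProductSpace ℂ H] [CompleteSpace H]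
  {ρ : Γ →* unitary (H →L[ℂ] H)}

theorem inner_rho (g : Γ) (x y : H) :
    inner ℝ ((ρ g : H →L[ℂ] H) x) ((ρ g : H →L[ℂ] H) y) = inner ℝ x y := by
  change RCLike.re (inner ℂ _ _) = RCLike.re (inner ℂ x y)
  rw [ContinuousLinearMap.inner_map_map_of_mem_unitary (ρ g).2]

theorem norm_rho (g : Γ) (x : H) : ‖(ρ g : H →L[ℂ] H) x‖ = ‖x‖ :=
  ContinuousLinearMap.norm_map_of_mem_unitary (ρ g).2 x

theorem isAlternating_of_mem {k : ℕ} {φ : OrdSimplex X k → H}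
    (hφ : φ ∈ twistedCochains X ρ k) : IsAlternating φ := hφ.1

theorem norm_sq_invariant {k : ℕ} {φ : OrdSimplex X k → H}
    (hφ : φ ∈ twistedCochains X ρ k) : IsOrbitInvariant Γ fun σ => ‖φ σ‖ ^ 2 := fun g σ => by
  beta_reduce
  rw [hφ.2, norm_rho]

theorem norm_perm {k : ℕ} {φ : OrdSimplex X k → H} (hφ : IsAlternating φ)
    (σ : OrdSimplex X k) (a b : Fin (k + 1)) :
    ‖φ (σ.perm (Equiv.swap a b))‖ = ‖φ σ‖ := by
  by_cases hab : a = b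
  · subst hab
    rw [Equiv.swap_self]
    rfl
  · rw [hφ.perm_swap σ hab, norm_neg]

variable (n) in
/-- The unnormalized codifferential `∑ m(vτ) φ(vτ)`. -/
noncomputable def cofaceSum {k : ℕ} (φ : OrdSimplex X (k + 1) → H) (τ : OrdSimplex X k) : H :=
  ∑ σ ∈ coface τ, mult n σ • φ σ

variable (n) in
/-- The codifferential `∑ (m(vτ)/m(τ)) φ(vτ)` on functions with values in a Hilbert space. -/
noncomputable def codiffVec {k : ℕ} (φ : OrdSimplex X (k + 1) → H) (τ : OrdSimplex X k) : H :=
  (mult n τ)⁻¹ • cofaceSum n φ τ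

variable (X n) in
/-- `λ_τ - k(n-k)/(k+1)` for the face of a `k`-simplex, where `k = j+1`. -/
noncomputable def shifted {j : ℕ} (τ : OrdSimplex X j) : ℝ :=
  shiftedEigenvalue X n (j + 1) τ.vertices

variable (X n) in
/-- The smallest positive eigenvalue of the link of an ordered simplex. -/
noncomputable def linkEigenvalue {j : ℕ} (τ : OrdSimplex X j) : ℝ :=
  smallestPosEigenvalue (link X τ.vertices) (n - (j + 1))

/-- A codimension one face is determined by the vertex it omits. -/
theorem faceSum_eq {j : ℕ} (σ : OrdSimplex X (j + 1)) :
    faceSum X n σ = ∑ i, shifted X n (σ.face i) := by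
  unfold faceSum shifted
  refine (Finset.sum_bij (fun i _ => (σ.face i).vertices) ?_ ?_ ?_ ?_).symm
  · intro i _
    rw [Finset.mem_powersetCard, OrdSimplex.card_vertices, OrdSimplex.vertices_face]
    exact ⟨Finset.erase_subset _ _, rfl⟩
  · intro i _ i' _ h
    rw [OrdSimplex.vertices_face, OrdSimplex.vertices_face] at h
    exact σ.1.injective ((Finset.erase_inj _ (σ.apply_mem_vertices i)).1 h)
  · intro t ht
    rw [Finset.mem_powersetCard] at ht
    obtain ⟨v, hv, hv'⟩ : ∃ v ∈ σ.vertices, v ∉ t := by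
      by_contra! hcon
      have := Finset.card_le_card hcon
      rw [OrdSimplex.card_vertices] at this
      omega
    obtain ⟨i, rfl⟩ := OrdSimplex.mem_vertices.1 hv
    refine ⟨i, Finset.mem_univ _, ?_⟩
    rw [OrdSimplex.vertices_face]
    refine (Finset.eq_of_subset_of_card_le (Finset.subset_erase.2 ⟨ht.1, hv'⟩) ?_).symm
    rw [Finset.card_erase_of_mem hv, OrdSimplex.card_vertices, ht.2]
    rfl
  · intro i _
    rfl

theorem shifted_invariant (hX : IsLocallyFinite X)
    (hX_pure : ∀ s ∈ X.faces, 1 ≤ topCount X n s) {j : ℕ} (hj : j + 1 ≤ n) :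
    IsOrbitInvariant Γ (shifted X n : OrdSimplex X j → ℝ) := by
  intro g τ
  have := shiftedEigenvalue_smul hX hX_pure τ.vertices_nonempty (by simpa using hj) g
  rw [OrdSimplex.card_vertices] at this
  rw [shifted, vertices_smul, this, shifted]

theorem faceSum_invariant (hX : IsLocallyFinite X)
    (hX_pure : ∀ s ∈ X.faces, 1 ≤ topCount X n s) {j : ℕ} (hj : j + 1 ≤ n) :
    IsOrbitInvariant Γ (fun σ : OrdSimplex X (j + 1) => faceSum X n σ) := by
  intro g σ
  simp only [faceSum_eq, smul_face]
  exact Finset.sum_congr rfl fun i _ => shifted_invariant hX hX_pure hj g _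

theorem linkEigenvalue_nonneg {j : ℕ} (τ : OrdSimplex X j) : 0 ≤ linkEigenvalue X n τ :=
  smallestPosEigenvalue_nonneg _ _

theorem linkEigenvalue_le (hX : IsLocallyFinite X)
    (hX_pure : ∀ s ∈ X.faces, 1 ≤ topCount X n s) {j : ℕ} (hj : j + 1 ≤ n)
    (τ : OrdSimplex X j) : linkEigenvalue X n τ ≤ 2 * n := by
  have := smallestPosEigenvalue_le hX hX_pure τ.vertices_nonempty (by simpa using hj)
  rwa [OrdSimplex.card_vertices] at this

theorem shifted_eq {j : ℕ} (τ : OrdSimplex X j) :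
    shifted X n τ = linkEigenvalue X n τ - (j + 1 : ℝ) * (n - (j + 1)) / (j + 2) := by
  unfold shifted shiftedEigenvalue linkEigenvalue
  push_cast
  ring

/-- The energy of the localization of `φ` on the link of `τ` is bounded below by the smallest
positive eigenvalue of the link. -/
theorem localized_poincare (hX : IsLocallyFinite X)
    (hX_pure : ∀ s ∈ X.faces, 1 ≤ topCount X n s) (hX_links : HasConnectedLinks X n)
    {j : ℕ} (hj : j + 1 < n) (φ : OrdSimplex X (j + 1) → H) (τ : OrdSimplex X j) :
    linkEigenvalue X n τ * (∑ σ ∈ coface τ, mult n σ * ‖φ σ‖ ^ 2 -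
        ‖cofaceSum n φ τ‖ ^ 2 / ((n - j) * mult n τ)) ≤
      ∑ σ ∈ coface τ, ∑ η ∈ coface σ,
        mult n η * (1 / 2 * ‖φ (η.face 0) - φ (η.face 1)‖ ^ 2) := by
  have h := link_poincare (n := n) hX hX_pure hX_links τ.vertices_mem (by simpa using hj)
    fun v => φ (τ.cons v)
  have h1 : ∑ σ ∈ coface τ, mult n σ * ‖φ σ‖ ^ 2 =
      ∑ u : linkFinset X τ.vertices,
        (topCount X n (insert u.1 τ.vertices) : ℝ) * ‖φ (τ.cons u)‖ ^ 2 := by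
    rw [sum_coface]
    simp only [mult, OrdSimplex.vertices_cons]
  have h2 : cofaceSum n φ τ = ∑ u : linkFinset X τ.vertices,
      (topCount X n (insert u.1 τ.vertices) : ℝ) • φ (τ.cons u) := by
    rw [cofaceSum, sum_coface]
    simp only [mult, OrdSimplex.vertices_cons]
  rw [OrdSimplex.card_vertices] at h
  rw [h1, h2, linkEigenvalue]
  have h3 : ((n : ℝ) + 1 - ((j + 1 : ℕ) : ℝ)) = n - j := by push_cast; ring
  rw [h3] at h
  refine h.trans (le_of_eq ?_)
  rw [sum_coface, Finset.mul_sum]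
  refine Finset.sum_congr rfl fun u _ => ?_
  -- Extension by zero allows one function on `V` to be summed over the links of both `τ` and `uτ`.
  -- For `η = vuτ` the faces `0` and `1` are `uτ` and `vτ`, so the energy of the localized function
  -- is a sum over `η`.
  let F : V → H := fun v => if h : v ∈ linkFinset X τ.vertices then φ (τ.cons ⟨v, h⟩) else 0
  have hF : ∀ v : linkFinset X τ.vertices, φ (τ.cons v) = F v := fun v => by simp [F]
  simp only [hF]
  rw [Finset.sum_coe_sort (linkFinset X τ.vertices) fun v =>
    linkWeight X n τ.vertices u v * ‖F u - F v‖ ^ 2]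
  have h4 := sum_linkWeight_smul (n := n) hX τ.vertices_nonempty u.1 fun v => ‖F u - F v‖ ^ 2
  simp only [smul_eq_mul] at h4
  rw [← h4, sum_coface, Finset.mul_sum, ← OrdSimplex.vertices_cons, ← Finset.sum_coe_sort]
  refine Finset.sum_congr rfl fun v _ => ?_
  have h5 : φ (((τ.cons u).cons v).face 0) = F u := by rw [OrdSimplex.cons_face_zero, hF]
  have h6 : φ (((τ.cons u).cons v).face 1) = F v := by
    have hmem : v.1 ∈ linkFinset X τ.vertices := by
      have hprop : ∀ w, w ∈ linkFinset X (τ.cons u).vertices →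
          w ∉ insert u.1 τ.vertices ∧ insert w (insert u.1 τ.vertices) ∈ X.faces := fun w hw => by
        rw [← OrdSimplex.vertices_cons]
        exact prop_of_mem_linkFinset hw
      have := hprop v.1 v.2
      rw [mem_linkFinset hX τ.vertices_nonempty]
      refine ⟨fun h => this.1 (Finset.mem_insert_of_mem h), ?_⟩
      exact (X.isRelLowerSet_faces this.2).2
        (Finset.insert_subset_insert _ (Finset.subset_insert _ _)) (Finset.insert_nonempty _ _)
    rw [← hF ⟨v.1, hmem⟩]
    congr 1
    refine OrdSimplex.ext' fun i => ?_
    rw [OrdSimplex.face_apply]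
    cases i using Fin.cases with
    | zero => rfl
    | succ i => rw [← Fin.succ_zero_eq_one, Fin.succ_succAbove_succ]; simp
  rw [h5, h6, mult, OrdSimplex.vertices_cons (τ.cons u) v]
  ring

/-- Cauchy–Schwarz with weights `m(vτ)`, whose sum is `(n - j) m(τ)`. -/
theorem norm_cofaceSum_sq_le (hX : IsLocallyFinite X) {j : ℕ} (hj : j ≤ n)
    (φ : OrdSimplex X (j + 1) → H) (τ : OrdSimplex X j) :
    ‖cofaceSum n φ τ‖ ^ 2 ≤ (n - j) * mult n τ * ∑ σ ∈ coface τ, mult n σ * ‖φ σ‖ ^ 2 := by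
  have h1 : ‖cofaceSum n φ τ‖ ≤ ∑ σ ∈ coface τ, mult n σ * ‖φ σ‖ := by
    refine (norm_sum_le _ _).trans (le_of_eq (Finset.sum_congr rfl fun σ _ => ?_))
    rw [norm_smul, Real.norm_of_nonneg (mult_nonneg σ)]
  refine (pow_le_pow_left₀ (norm_nonneg _) h1 2).trans ?_
  rw [← sum_mult_coface hX hj]
  refine Finset.sum_sq_le_sum_mul_sum_of_sq_le_mul _ (fun σ _ => mult_nonneg σ)
    (fun σ _ => mul_nonneg (mult_nonneg σ) (sq_nonneg _)) fun σ _ => le_of_eq (by ring)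

variable [TopologicalSpace Γ] [IsTopologicalGroup Γ] [MeasurableSpace Γ] [BorelSpace Γ]
  (μ : Measure Γ) [μ.IsHaarMeasure] [μ.IsMulRightInvariant]
  (hX : IsLocallyFinite X) (hX_pure : ∀ s ∈ X.faces, 1 ≤ topCount X n s)
  (hX_links : HasConnectedLinks X n) (hΓ : IsProperAction Γ X)
  {R : ∀ j : ℕ, Set (OrdSimplex X j)} (hR : ∀ j : ℕ, IsOrbitTransversal Γ (R j))

theorem abs_inner_le_sq_add_sq {H : Type*} [NormedAddCommGroup H] [InnerProductSpace ℝ H]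
    (x y : H) : |inner ℝ x y| ≤ ‖x‖ ^ 2 + ‖y‖ ^ 2 := by
  have := abs_real_inner_le_norm x y
  nlinarith [sq_nonneg (‖x‖ - ‖y‖), norm_nonneg x, norm_nonneg y]

variable {j : ℕ} {φ : OrdSimplex X (j + 1) → H} (hφ : φ ∈ twistedCochains X ρ (j + 1)) {N : ℝ}
  (hN : HasOrbitSum μ (R (j + 1)) (fun σ => mult n σ * ‖φ σ‖ ^ 2) N)

include hX hΓ hR hφ hN in
/-- The total energy of the localizations of a cocycle on the links. -/
theorem hasOrbitSum_energy (hj : j + 1 < n) (hd : diff X ℂ H (j + 1) φ = 0) :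
    HasOrbitSum μ (R (j + 2)) (fun η => mult n η * (1 / 2 * ‖φ (η.face 0) - φ (η.face 1)‖ ^ 2))
      ((j + 1 : ℝ) * (n - (j + 1)) / (j + 2) * N) := by
  have hφa := isAlternating_of_mem hφ
  have hface : ∀ i, HasOrbitSum μ (R (j + 2)) (fun η => mult n η * ‖φ (η.face i)‖ ^ 2)
      ((n - (j + 1 : ℕ)) * N) :=
    fun i => hN.face μ hX hΓ hR hj.le (norm_sq_invariant hφ) i
  have hinv : ∀ i i', IsOrbitInvariant Γ fun η : OrdSimplex X (j + 2) =>
      mult n η * inner ℝ (φ (η.face i)) (φ (η.face i')) := fun i i' => by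
    refine (mult_invariant _).mul fun g η => ?_
    rw [smul_face, smul_face, hφ.2, hφ.2, inner_rho]
  obtain ⟨c, hc⟩ : ∃ c, HasOrbitSum μ (R (j + 2))
      (fun η => mult n η * inner ℝ (φ (η.face 0)) (φ (η.face 1))) c := by
    refine (OrbitSummable.of_abs_le μ (((hface 0).add μ (hface 1)).summable μ)
      fun η => ?_).exists_hasOrbitSum μ
    rw [abs_mul, abs_of_nonneg (mult_nonneg η), ← mul_add]
    exact mul_le_mul_of_nonneg_left (abs_inner_le_sq_add_sq _ _) (mult_nonneg η)
  -- Swapping the neighbouring vertices `i + 1` and `i + 2` carries one later face to the next and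
  -- permutes face `0` by a transposition, so the mixed sums alternate in sign.
  have hci : ∀ i : Fin (j + 2), HasOrbitSum μ (R (j + 2))
      (fun η => mult n η * inner ℝ (φ (η.face 0)) (φ (η.face i.succ))) ((-1) ^ (i : ℕ) * c) := by
    intro i
    induction i using Fin.induction with
    | zero => simpa using hc
    | succ i ih =>
      have := (ih.perm μ hΓ hR (hinv _ _)
        (Equiv.swap i.succ.castSucc i.succ.succ)).const_mul μ (-1)
      have hval : -1 * ((-1) ^ (i.castSucc : ℕ) * c) = (-1) ^ (i.succ : ℕ) * c := by
        simp only [Fin.val_castSucc, Fin.val_succ, pow_succ]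
        ring
      rw [hval] at this
      refine Eq.mp (congrArg (fun f => HasOrbitSum μ (R (j + 2)) f _) ?_) this
      funext η
      rw [mult_perm, Fin.succ_castSucc, OrdSimplex.face_castSucc_perm_swap]
      obtain ⟨a', b', hab, h⟩ := η.face_perm_swap (i := 0)
        (Fin.castSucc_lt_succ (i := i.succ)).ne
        (by rw [← Fin.succ_castSucc]; exact Fin.succ_ne_zero _) (Fin.succ_ne_zero _)
      rw [h, hφa.perm_swap _ hab, inner_neg_left]
      ring
  -- The cocycle equation paired with `φ (η.face 0)`. After summation it reads `(n - j - 1) N = (j +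
  -- 2) c`, which determines the mixed term `c`.
  have hzero : ∀ η : OrdSimplex X (j + 2), mult n η * ‖φ (η.face 0)‖ ^ 2 +
      ∑ i : Fin (j + 2), (-1) ^ ((i : ℕ) + 1) *
        (mult n η * inner ℝ (φ (η.face 0)) (φ (η.face i.succ))) = 0 := by
    intro η
    have h1 := congrFun hd η
    rw [diff_apply, Fin.sum_univ_succ] at h1
    have h2 := congrArg (fun x => mult n η * inner ℝ (φ (η.face 0)) x) h1
    simp only [inner_add_right, inner_sum, Pi.zero_apply, inner_zero_right, mul_zero,
      Fin.val_zero, pow_zero, one_smul, real_inner_self_eq_norm_sq, mul_add, Fin.val_succ,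
      Finset.mul_sum] at h2
    rw [← h2]
    congr 1
    refine Finset.sum_congr rfl fun i _ => ?_
    rw [← Int.cast_smul_eq_zsmul ℝ, inner_smul_right]
    push_cast
    ring
  have hsum := (hface 0).add μ
    (HasOrbitSum.sum μ fun i : Fin (j + 2) => (hci i).const_mul μ ((-1) ^ ((i : ℕ) + 1)))
  simp only [hzero] at hsum
  have h0 : HasOrbitSum μ (R (j + 2)) (fun _ => 0) 0 := by
    unfold HasOrbitSum
    simpa using hasSum_zero
  have heq := hsum.unique μ h0
  have hterm : ∀ i : Fin (j + 2), (-1 : ℝ) ^ ((i : ℕ) + 1) * ((-1) ^ (i : ℕ) * c) = -c := by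
    intro i
    rw [← mul_assoc, ← pow_add, show (i : ℕ) + 1 + i = 2 * i + 1 by ring, pow_succ, pow_mul]
    simp
  simp only [hterm, Finset.sum_const, Finset.card_univ, Fintype.card_fin, nsmul_eq_mul] at heq
  have hfin := (((hface 0).add μ (hface 1)).add μ (hc.const_mul μ (-2))).const_mul μ (1 / 2)
  have hval : 1 / 2 * ((n - (j + 1 : ℕ)) * N + (n - (j + 1 : ℕ)) * N + -2 * c) =
      (j + 1 : ℝ) * (n - (j + 1)) / (j + 2) * N := by
    push_cast at heq ⊢
    have hj2 : (j : ℝ) + 2 ≠ 0 := by positivity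
    have : c = (n - (j + 1)) * N / (j + 2) := by
      field_simp
      linarith
    rw [this]
    field_simp
    ring
  rw [hval] at hfin
  refine Eq.mp (congrArg (fun f => HasOrbitSum μ (R (j + 2)) f _) ?_) hfin
  funext η
  rw [@norm_sub_sq_real]
  ring

include hX hX_pure hΓ hR hφ hN in
/-- The codifferential is bounded. -/
theorem exists_hasOrbitSum_cofaceSum (hj : j ≤ n) :
    OrbitSummable μ (R j) (fun τ => ‖cofaceSum n φ τ‖ ^ 2 / mult n τ) := by
  have h1 := hN.coface μ hX hΓ hR ((mult_invariant _).mul (norm_sq_invariant hφ))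
  refine OrbitSummable.of_abs_le μ ((h1.const_mul μ (n - j)).summable μ) fun τ => ?_
  rw [abs_of_nonneg (div_nonneg (sq_nonneg _) (mult_nonneg τ)),
    div_le_iff₀ (mult_pos hX_pure τ)]
  refine (norm_cofaceSum_sq_le hX hj φ τ).trans (le_of_eq ?_)
  ring

include hX hX_pure hX_links hΓ hR hφ hN in
/-- Garland's estimate for cocycles. -/
theorem garland_estimate (hj : j + 1 < n) (hd : diff X ℂ H (j + 1) φ = 0)
    {t : ℝ} (ht : HasOrbitSum μ (R (j + 1))
      (fun σ => mult n σ * (shifted X n (σ.face 0) * ‖φ σ‖ ^ 2)) t) {M : ℝ}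
    (hM : HasOrbitSum μ (R j) (fun τ => ‖cofaceSum n φ τ‖ ^ 2 / mult n τ) M) :
    t ≤ 2 * n / (n - j) * M := by
  have hnj : (0 : ℝ) < n - j := by
    rw [sub_pos, Nat.cast_lt]
    omega
  have hshift : IsOrbitInvariant Γ (shifted X n : OrdSimplex X j → ℝ) :=
    shifted_invariant hX hX_pure hj.le
  have hE := ((hasOrbitSum_energy μ hX hΓ hR hφ hN hj hd).coface μ hX hΓ hR
    ((mult_invariant _).mul fun g η => by
      simp only [smul_face, hφ.2, ← map_sub, norm_rho])).coface μ hX hΓ hR (fun g σ => by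
        refine Finset.sum_nbij' (fun η => g⁻¹ • η) (fun η => g • η) ?_ ?_ ?_ ?_ ?_
        · intro η hη
          rw [mem_coface hX] at hη ⊢
          rw [smul_face, hη, inv_smul_smul]
        · intro η hη
          rw [mem_coface hX] at hη ⊢
          rw [smul_face, hη]
        · simp
        · simp
        · intro η _
          rw [mult_invariant]
          simp only [smul_face, hφ.2, ← map_sub, norm_rho])
  have hA := hN.coface μ hX hΓ hR ((mult_invariant _).mul (norm_sq_invariant hφ))
  have hT := ht.coface μ hX hΓ hR
    ((mult_invariant _).mul ((hshift.face 0).mul (norm_sq_invariant hφ)))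
  -- The total energy cancels exactly against the shift times `N`, leaving only the codifferential
  -- term; the comparison is then made separately at each `τ`.
  have hrhs := (hE.add μ (hA.const_mul μ (-((j + 1 : ℝ) * (n - (j + 1)) / (j + 2))))).add μ
    (hM.const_mul μ (2 * n / (n - j)))
  refine (hT.mono μ hrhs fun τ _ => ?_).trans (le_of_eq (by ring))
  have h1 := localized_poincare hX hX_pure hX_links hj φ τ
  have h2 : ∑ σ ∈ coface τ, mult n σ * (shifted X n (σ.face 0) * ‖φ σ‖ ^ 2) =
      shifted X n τ * ∑ σ ∈ coface τ, mult n σ * ‖φ σ‖ ^ 2 := by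
    rw [Finset.mul_sum]
    refine Finset.sum_congr rfl fun σ hσ => ?_
    rw [(mem_coface hX σ τ).1 hσ]
    ring
  rw [h2, shifted_eq]
  have h3 : linkEigenvalue X n τ * (‖cofaceSum n φ τ‖ ^ 2 / ((n - j) * mult n τ)) ≤
      2 * n / (n - j) * (‖cofaceSum n φ τ‖ ^ 2 / mult n τ) := by
    have h4 : ‖cofaceSum n φ τ‖ ^ 2 / ((n - j) * mult n τ) =
        1 / (n - j) * (‖cofaceSum n φ τ‖ ^ 2 / mult n τ) := by
      have := (mult_pos hX_pure τ).ne'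
      field_simp
    rw [h4, ← mul_assoc, mul_one_div]
    refine mul_le_mul_of_nonneg_right ?_ (div_nonneg (sq_nonneg _) (mult_nonneg τ))
    exact div_le_div_of_nonneg_right (linkEigenvalue_le hX hX_pure hj.le τ) hnj.le
  linarith

include hX hX_pure hΓ hR hφ hN in
-- The shifted eigenvalues are uniformly bounded, so the sums converge. Reordering vertices leaves
-- `‖φ(σ)‖` unchanged, so each of the `j + 2` faces contributes the same amount `t`.
theorem hasOrbitSum_faceSum (hj : j + 1 ≤ n) :
    ∃ t, HasOrbitSum μ (R (j + 1))
      (fun σ => mult n σ * (shifted X n (σ.face 0) * ‖φ σ‖ ^ 2)) t ∧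
    HasOrbitSum μ (R (j + 1)) (fun σ => mult n σ * (faceSum X n σ * ‖φ σ‖ ^ 2))
      ((j + 2) * t) := by
  have hshift : IsOrbitInvariant Γ (shifted X n : OrdSimplex X j → ℝ) :=
    shifted_invariant hX hX_pure hj
  set C := (j + 1 : ℝ) * (n - (j + 1)) / (j + 2) with hC
  obtain ⟨t, ht⟩ : ∃ t, HasOrbitSum μ (R (j + 1))
      (fun σ => mult n σ * (shifted X n (σ.face 0) * ‖φ σ‖ ^ 2)) t := by
    refine (OrbitSummable.of_abs_le μ ((hN.const_mul μ (2 * n + |C|)).summable μ)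
      fun σ => ?_).exists_hasOrbitSum μ
    rw [abs_mul, abs_of_nonneg (mult_nonneg σ), abs_mul, abs_of_nonneg (sq_nonneg ‖φ σ‖)]
    have h1 : |shifted X n (σ.face 0)| ≤ 2 * n + |C| := by
      rw [shifted_eq, ← hC]
      refine (abs_sub _ _).trans (add_le_add_left ?_ _)
      rw [abs_of_nonneg (linkEigenvalue_nonneg _)]
      exact linkEigenvalue_le hX hX_pure hj _
    have h2 : 0 ≤ mult n σ * ‖φ σ‖ ^ 2 := mul_nonneg (mult_nonneg σ) (sq_nonneg _)
    nlinarith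
  refine ⟨t, ht, ?_⟩
  have hti : ∀ i, HasOrbitSum μ (R (j + 1))
      (fun σ => mult n σ * (shifted X n (σ.face i) * ‖φ σ‖ ^ 2)) t := by
    intro i
    induction i using Fin.induction with
    | zero => exact ht
    | succ i ih =>
      have := ih.perm μ hΓ hR
        ((mult_invariant _).mul ((hshift.face _).mul (norm_sq_invariant hφ)))
        (Equiv.swap i.castSucc i.succ)
      simpa only [mult_perm, OrdSimplex.face_castSucc_perm_swap,
        norm_perm (isAlternating_of_mem hφ)] using this
  have := HasOrbitSum.sum μ hti
  simp only [Finset.sum_const, Finset.card_univ, Fintype.card_fin, nsmul_eq_mul] at this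
  push_cast at this
  refine Eq.mp (congrArg (fun f => HasOrbitSum μ (R (j + 1)) f _) ?_) this
  funext σ
  rw [faceSum_eq, Finset.sum_mul, Finset.mul_sum]

include hX hX_pure hX_links hΓ hR hφ hN in
/-- The codifferential is bounded below on cocycles. -/
theorem le_codiff_of_detPoly (hd : diff X ℂ H (j + 1) φ = 0) {l : ℕ} (hkl : j + 1 < l) (hl : l ≤ n)
    {ε : ℝ}
    (h : ∀ γ ∈ R l, ∀ x : ℝ, MvPolynomial.eval
      (fun f : Fin (j + 1 + 1) ↪o Fin (l + 1) => x - faceSum X n (γ.sub f))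
      (detPoly (j + 1) l) = 0 → ε ≤ x) {M : ℝ}
    (hM : HasOrbitSum μ (R j) (fun τ => ‖cofaceSum n φ τ‖ ^ 2 / mult n τ) M) :
    ε * N ≤ (j + 2) * (2 * n / (n - j)) * M := by
  have hj : j + 1 < n := by omega
  obtain ⟨t, ht, hS⟩ := hasOrbitSum_faceSum μ hX hX_pure hΓ hR hφ hN hj.le
  have h1 := garland_estimate μ hX hX_pure hX_links hΓ hR hφ hN hj hd ht hM
  obtain ⟨c, hc, hcount⟩ := exists_reindex_const (n := n) μ hX hΓ hR (j + 1) l hkl.le hl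
  have h2 := HasOrbitSum.sum μ fun f : Fin (j + 1 + 1) ↪o Fin (l + 1) =>
    hcount f.toEmbedding _ (norm_sq_invariant hφ) _ hN
  have h3 := HasOrbitSum.sum μ fun f : Fin (j + 1 + 1) ↪o Fin (l + 1) =>
    hcount f.toEmbedding _
      ((faceSum_invariant hX hX_pure hj.le).mul (norm_sq_invariant hφ)) _ hS
  -- The determinant condition is applied on each representative `γ`. Both sides then carry the same
  -- factor, `c` times the number of `k`-faces of an `l`-simplex, which cancels.
  have h4 := (h2.const_mul μ ε).mono μ h3 fun γ hγ => by
    have h5 := le_faceSum_form γ (h γ hγ) (φ := φ) hd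
    rw [← Finset.mul_sum, ← Finset.mul_sum, mul_left_comm]
    exact mul_le_mul_of_nonneg_left h5 (mult_nonneg γ)
  simp only [Finset.sum_const, Finset.card_univ, nsmul_eq_mul] at h4
  have h6 : 0 < (Fintype.card (Fin (j + 1 + 1) ↪o Fin (l + 1)) : ℝ) := by
    rw [Nat.cast_pos, Fintype.card_pos_iff]
    exact ⟨Fin.castLEOrderEmb (by omega)⟩
  have h7 : ε * N ≤ (j + 2) * t := by
    have h8 : Fintype.card (Fin (j + 1 + 1) ↪o Fin (l + 1)) * c * (ε * N) ≤
        Fintype.card (Fin (j + 1 + 1) ↪o Fin (l + 1)) * c * ((j + 2) * t) := by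
      linarith
    exact le_of_mul_le_mul_left h8 (mul_pos h6 hc)
  refine h7.trans ?_
  rw [mul_assoc]
  exact mul_le_mul_of_nonneg_left h1 (by positivity)

end Garland

/-! ## Square integrable cochains as a Hilbert space -/

section Hilbert

attribute [local instance 10] InnerProductSpace.complexToReal

variable {V : Type*} [DecidableEq V] {X : PreAbstractSimplicialComplex V} {n : ℕ}
  {Γ : Type*} [Group Γ] [MulAction Γ V] [IsSimplicialAction Γ X]
  {H : Type*} [NormedAddCommGroup H] [InnerProductSpace ℂ H] [CompleteSpace H]
  {ρ : Γ →* unitary (H →L[ℂ] H)}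

/-- Transposing two vertices of `τ` transposes the shifted positions in `vτ`, a bijection between
the two sets of cofaces. -/
theorem cofaceSum_perm_swap (hX : IsLocallyFinite X) {j : ℕ} {φ : OrdSimplex X (j + 1) → H}
    (hφ : IsAlternating φ) (τ : OrdSimplex X j) {a b : Fin (j + 1)} (hab : a ≠ b) :
    cofaceSum n φ (τ.perm (Equiv.swap a b)) = -cofaceSum n φ τ := by
  have hswap : ∀ σ : OrdSimplex X (j + 1),
      (σ.perm (Equiv.swap a.succ b.succ)).face 0 = (σ.face 0).perm (Equiv.swap a b) := fun σ => by
    refine OrdSimplex.ext' fun x => ?_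
    simp only [OrdSimplex.face_apply, OrdSimplex.perm_apply, Fin.zero_succAbove]
    rw [Function.Injective.swap_apply (Fin.succ_injective _)]
  have hinv : ∀ {k : ℕ} (σ : OrdSimplex X k) (a b : Fin (k + 1)),
      (σ.perm (Equiv.swap a b)).perm (Equiv.swap a b) = σ := fun σ a b => by
    rw [OrdSimplex.perm_perm, Equiv.swap_mul_self]
    rfl
  rw [cofaceSum, cofaceSum, ← Finset.sum_neg_distrib]
  refine Finset.sum_nbij' (fun σ => σ.perm (Equiv.swap a.succ b.succ))
    (fun σ => σ.perm (Equiv.swap a.succ b.succ)) ?_ ?_ (fun σ _ => hinv σ _ _)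
    (fun σ _ => hinv σ _ _) ?_
  · intro σ hσ
    rw [mem_coface hX] at hσ ⊢
    rw [hswap, hσ, hinv]
  · intro σ hσ
    rw [mem_coface hX] at hσ ⊢
    rw [hswap, hσ]
  · intro σ _
    rw [hφ.perm_swap _ (fun h => hab (Fin.succ_injective _ h)), mult_perm, smul_neg, neg_neg]

theorem codiffVec_mem (hX : IsLocallyFinite X) {j : ℕ} {φ : OrdSimplex X (j + 1) → H}
    (hφ : φ ∈ twistedCochains X ρ (j + 1)) : codiffVec n φ ∈ twistedCochains X ρ j := by
  refine ⟨isAlternating_of_adjacent fun τ i => ?_, fun g τ => ?_⟩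
  · rw [codiffVec, mult_perm, cofaceSum_perm_swap hX hφ.1 τ (Fin.castSucc_lt_succ).ne, smul_neg,
      codiffVec]
  · rw [codiffVec, codiffVec, mult_invariant, ← Complex.coe_smul, ← Complex.coe_smul, map_smul]
    congr 1
    rw [cofaceSum, cofaceSum, map_sum]
    refine Finset.sum_nbij' (fun η => g⁻¹ • η) (fun η => g • η) ?_ ?_ ?_ ?_ ?_
    · intro η hη
      rw [mem_coface hX] at hη ⊢
      rw [smul_face, hη, inv_smul_smul]
    · intro η hη
      rw [mem_coface hX] at hη ⊢
      rw [smul_face, hη]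
    · simp
    · simp
    · intro η _
      rw [mult_invariant, ← Complex.coe_smul, ← Complex.coe_smul, map_smul, ← hφ.2,
        smul_inv_smul]

theorem diff_mem {j : ℕ} {ψ : OrdSimplex X j → H} (hψ : ψ ∈ twistedCochains X ρ j) :
    diff X ℝ H j ψ ∈ twistedCochains X ρ (j + 1) := by
  refine ⟨IsAlternating.diff (isAlternating_of_mem hψ), fun g σ => ?_⟩
  rw [diff_apply, diff_apply, map_sum]
  refine Finset.sum_congr rfl fun i _ => ?_
  rw [smul_face, hψ.2, map_zsmul]

theorem norm_diff_sq_le {j : ℕ} (ψ : OrdSimplex X j → H) (σ : OrdSimplex X (j + 1)) :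
    ‖diff X ℝ H j ψ σ‖ ^ 2 ≤ (j + 2) * ∑ i, ‖ψ (σ.face i)‖ ^ 2 := by
  have h1 : ‖diff X ℝ H j ψ σ‖ ≤ ∑ i, ‖ψ (σ.face i)‖ := by
    rw [diff_apply]
    refine (norm_sum_le _ _).trans (le_of_eq (Finset.sum_congr rfl fun i _ => ?_))
    rcases neg_one_pow_eq_or ℤ (i : ℕ) with h | h <;> simp [h]
  refine (pow_le_pow_left₀ (norm_nonneg _) h1 2).trans (sq_sum_le_card_mul_sum_sq.trans ?_)
  simp only [Finset.card_univ, Fintype.card_fin]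
  push_cast
  exact le_rfl

/-- The defining equations involve finitely many values at a time, so they are closed conditions for
pointwise convergence. -/
theorem isClosed_twistedCochains (k : ℕ) :
    IsClosed (twistedCochains X ρ k : Set (OrdSimplex X k → H)) := by
  have : (twistedCochains X ρ k : Set (OrdSimplex X k → H)) =
      (⋂ (σ : OrdSimplex X k) (π : Equiv.Perm (Fin (k + 1))),
        {φ | φ (σ.perm π) = (Equiv.Perm.sign π : ℤ) • φ σ}) ∩
      ⋂ (g : Γ) (σ : OrdSimplex X k), {φ | φ (g • σ) = (ρ g : H →L[ℂ] H) (φ σ)} := by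
    ext φ
    simp only [Set.mem_inter_iff, Set.mem_iInter, Set.mem_ofPred_eq]
    rfl
  rw [this]
  refine (isClosed_iInter fun σ => isClosed_iInter fun π => ?_).inter
    (isClosed_iInter fun g => isClosed_iInter fun σ => ?_)
  · exact isClosed_eq (continuous_apply _) ((continuous_apply σ).fun_const_smul _)
  · exact isClosed_eq (continuous_apply _) ((ρ g : H →L[ℂ] H).continuous.comp (continuous_apply σ))

theorem isClosed_ker_diff (k : ℕ) :
    IsClosed (LinearMap.ker (diff X ℝ H k) : Set (OrdSimplex X k → H)) := by
  have : (LinearMap.ker (diff X ℝ H k) : Set (OrdSimplex X k → H)) =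
      ⋂ σ : OrdSimplex X (k + 1),
        {φ | ∑ i : Fin (k + 2), (-1 : ℤ) ^ (i : ℕ) • φ (σ.face i) = 0} := by
    ext φ
    simp only [Set.mem_iInter, Set.mem_ofPred_eq, SetLike.mem_coe, LinearMap.mem_ker]
    exact ⟨fun h σ => congrFun h σ, fun h => funext h⟩
  rw [this]
  refine isClosed_iInter fun σ => isClosed_eq ?_ continuous_const
  exact continuous_finsetSum _ fun i _ => (continuous_apply (σ.face i)).fun_const_smul _

variable [TopologicalSpace Γ] [IsTopologicalGroup Γ] [MeasurableSpace Γ] [BorelSpace Γ]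
  (μ : Measure Γ) [μ.IsHaarMeasure]

variable (n) in
/-- The square root of the weight of `σ`. -/
noncomputable def rootWeight {k : ℕ} (σ : OrdSimplex X k) : ℝ := √(mult n σ / stabVol μ σ)

theorem rootWeight_sq {k : ℕ} (σ : OrdSimplex X k) :
    rootWeight n μ σ * rootWeight n μ σ = mult n σ / stabVol μ σ :=
  Real.mul_self_sqrt (div_nonneg (mult_nonneg σ) measureReal_nonneg)

variable (n) in
/-- The space of square summable families over orbit representatives which come from a cochain
in `P`. -/
def l2Image {k : ℕ} (R : Set (OrdSimplex X k)) (P : Submodule ℝ (OrdSimplex X k → H)) :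
    Submodule ℝ (lp (fun _ : R => H) 2) where
  carrier := {x | ∃ φ ∈ P, ∀ r : R, x r = rootWeight n μ r.1 • φ r}
  zero_mem' := ⟨0, P.zero_mem, fun r => by simp⟩
  add_mem' := by
    rintro x y ⟨φ, hφ, hx⟩ ⟨ψ, hψ, hy⟩
    exact ⟨φ + ψ, P.add_mem hφ hψ, fun r => by simp [hx, hy]⟩
  smul_mem' := by
    rintro c x ⟨φ, hφ, hx⟩
    exact ⟨c • φ, P.smul_mem c hφ, fun r => by simp [hx, smul_comm c]⟩

theorem hasOrbitSum_inner {k : ℕ} {R : Set (OrdSimplex X k)} {x y : lp (fun _ : R => H) 2}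
    {φ ψ : OrdSimplex X k → H} (hx : ∀ r : R, x r = rootWeight n μ r.1 • φ r)
    (hy : ∀ r : R, y r = rootWeight n μ r.1 • ψ r) :
    HasOrbitSum μ R (fun σ => mult n σ * inner ℝ (φ σ) (ψ σ)) (inner ℝ x y) := by
  refine Eq.mp (congrArg (fun f => HasSum f (inner ℝ x y)) (funext fun r => ?_))
    (lp.hasSum_inner (𝕜 := ℝ) x y)
  rw [hx, hy, real_inner_smul_left, real_inner_smul_right, ← mul_assoc, rootWeight_sq]
  ring

theorem exists_lp {k : ℕ} {R : Set (OrdSimplex X k)} {φ : OrdSimplex X k → H}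
    (h : OrbitSummable μ R fun σ => mult n σ * ‖φ σ‖ ^ 2) :
    ∃ x : lp (fun _ : R => H) 2, ∀ r : R, x r = rootWeight n μ r.1 • φ r := by
  refine ⟨⟨fun r => rootWeight n μ r.1 • φ r, memℓp_gen ?_⟩, fun r => rfl⟩
  refine Summable.congr h fun r => ?_
  rw [ENNReal.toReal_ofNat, Real.rpow_ofNat, norm_smul, mul_pow, Real.norm_eq_abs, sq_abs, sq,
    rootWeight_sq]
  ring

variable (hX_pure : ∀ s ∈ X.faces, 1 ≤ topCount X n s) (hΓ : IsProperAction Γ X)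

include hX_pure hΓ in
theorem rootWeight_pos {k : ℕ} (σ : OrdSimplex X k) : 0 < rootWeight n μ σ :=
  Real.sqrt_pos.2 (div_pos (mult_pos hX_pure σ) (stabVol_pos μ (hasCompactOpenStabilizers hΓ k) σ))

include hX_pure hΓ in
-- Equivariance determines a cochain from its values on representatives, and the root weights are
-- nonzero. Elements of `l2Image` therefore come from unique twisted cochains.
theorem eq_of_eq_on {k : ℕ} {R : Set (OrdSimplex X k)} (hR : IsOrbitTransversal Γ R)
    {φ ψ : OrdSimplex X k → H} (hφ : φ ∈ twistedCochains X ρ k) (hψ : ψ ∈ twistedCochains X ρ k)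
    (h : ∀ r : R, rootWeight n μ r.1 • φ r = rootWeight n μ r.1 • ψ r) : φ = ψ := by
  funext σ
  obtain ⟨r, ⟨hr, g, hg⟩, -⟩ := hR σ
  have h1 := smul_right_injective H (rootWeight_pos (n := n) μ hX_pure hΓ r).ne' (h ⟨r, hr⟩)
  have hσ : σ = g⁻¹ • r := by
    rw [← hg]
    simp
  simp only at h1
  rw [hσ, hφ.2, hψ.2, h1]

include hX_pure hΓ in
-- Convergence in `ℓ²` gives convergence on representatives, hence by equivariance at every simplex.
-- The pointwise limit stays in `P`. Closedness supplies the completeness needed for Lax–Milgram.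
theorem isClosed_l2Image {k : ℕ} {R : Set (OrdSimplex X k)} (hR : IsOrbitTransversal Γ R)
    {P : Submodule ℝ (OrdSimplex X k → H)} (hP : IsClosed (P : Set (OrdSimplex X k → H)))
    (hPt : ∀ φ ∈ P, φ ∈ twistedCochains X ρ k) :
    IsClosed (l2Image n μ R P : Set (lp (fun _ : R => H) 2)) := by
  refine IsSeqClosed.isClosed fun x y hx hy => ?_
  choose φ hφ hxφ using hx
  have hcoord : ∀ r : R, Filter.Tendsto (fun m => x m r) Filter.atTop (nhds (y r)) := fun r =>
    tendsto_pi_nhds.1 ((lp.uniformContinuous_coe.continuous.tendsto y).comp hy) r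
  have hlim : ∀ σ, ∃ z, Filter.Tendsto (fun m => φ m σ) Filter.atTop (nhds z) := by
    intro σ
    obtain ⟨r, ⟨hr, g, hg⟩, -⟩ := hR σ
    have hσ : σ = g⁻¹ • r := by
      rw [← hg]
      simp
    refine ⟨(ρ g⁻¹ : H →L[ℂ] H) ((rootWeight n μ r)⁻¹ • y ⟨r, hr⟩), ?_⟩
    have h1 := ((ρ g⁻¹ : H →L[ℂ] H).continuous.tendsto _).comp
      ((hcoord ⟨r, hr⟩).const_smul (rootWeight n μ r)⁻¹)
    refine h1.congr fun m => ?_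
    rw [Function.comp_apply, hxφ m ⟨r, hr⟩,
      inv_smul_smul₀ (rootWeight_pos (n := n) μ hX_pure hΓ r).ne', hσ, (hPt _ (hφ m)).2]
  choose φ' hφ' using hlim
  refine ⟨φ', hP.mem_of_tendsto (tendsto_pi_nhds.2 hφ') (Filter.Eventually.of_forall hφ),
    fun r => ?_⟩
  refine tendsto_nhds_unique (hcoord r) ?_
  simp only [hxφ]
  exact (hφ' r).const_smul _

variable [μ.IsMulRightInvariant]
  (hX : IsLocallyFinite X) (hX_links : HasConnectedLinks X n)
  {R : ∀ j : ℕ, Set (OrdSimplex X j)} (hR : ∀ j : ℕ, IsOrbitTransversal Γ (R j))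

include hX hΓ hR in
/-- The differential and the codifferential are adjoint up to normalization. -/
theorem hasOrbitSum_inner_diff {j : ℕ} (hj : j ≤ n) {φ : OrdSimplex X (j + 1) → H}
    (hφ : φ ∈ twistedCochains X ρ (j + 1))
    (hφ2 : OrbitSummable μ (R (j + 1)) fun σ => mult n σ * ‖φ σ‖ ^ 2)
    {ψ : OrdSimplex X j → H} (hψ : ψ ∈ twistedCochains X ρ j)
    (hψ2 : OrbitSummable μ (R j) fun σ => mult n σ * ‖ψ σ‖ ^ 2) :
    ∃ s, HasOrbitSum μ (R (j + 1)) (fun σ => mult n σ * inner ℝ (φ σ) (diff X ℝ H j ψ σ))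
      ((j + 2) * s) ∧
      HasOrbitSum μ (R j) (fun τ => inner ℝ (cofaceSum n φ τ) (ψ τ)) s := by
  obtain ⟨N, hN⟩ := hφ2.exists_hasOrbitSum μ
  obtain ⟨N', hN'⟩ := hψ2.exists_hasOrbitSum μ
  have hinv : ∀ i, IsOrbitInvariant Γ fun σ : OrdSimplex X (j + 1) =>
      mult n σ * inner ℝ (φ σ) (ψ (σ.face i)) := fun i => by
    refine (mult_invariant _).mul fun g η => ?_
    rw [smul_face, hφ.2, hψ.2, inner_rho]
  obtain ⟨s, hs⟩ : ∃ s, HasOrbitSum μ (R (j + 1))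
      (fun σ => mult n σ * inner ℝ (φ σ) (ψ (σ.face 0))) s := by
    refine (OrbitSummable.of_abs_le μ ((hN.add μ
      (hN'.face_zero μ hX hΓ hR hj (norm_sq_invariant hψ))).summable μ)
      fun η => ?_).exists_hasOrbitSum μ
    rw [abs_mul, abs_of_nonneg (mult_nonneg η), ← mul_add]
    exact mul_le_mul_of_nonneg_left (abs_inner_le_sq_add_sq _ _) (mult_nonneg η)
  -- An adjacent transposition negates `φ` and moves face `i` to face `i + 1`. The signs cancel
  -- those in `d`, so all `j + 2` terms of `⟪φ, dψ⟫` equal `s`; for face `0`, summing over cofaces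
  -- turns `s` into the pairing with the codifferential.
  have hi : ∀ i : Fin (j + 2), HasOrbitSum μ (R (j + 1))
      (fun σ => mult n σ * inner ℝ (φ σ) (ψ (σ.face i))) ((-1) ^ (i : ℕ) * s) := by
    intro i
    induction i using Fin.induction with
    | zero => simpa using hs
    | succ i ih =>
      have := (ih.perm μ hΓ hR (hinv _) (Equiv.swap i.castSucc i.succ)).const_mul μ (-1)
      have hval : -1 * ((-1) ^ (i.castSucc : ℕ) * s) = (-1) ^ (i.succ : ℕ) * s := by
        simp only [Fin.val_castSucc, Fin.val_succ, pow_succ]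
        ring
      rw [hval] at this
      refine Eq.mp (congrArg (fun f => HasOrbitSum μ (R (j + 1)) f _) ?_) this
      funext η
      rw [mult_perm, OrdSimplex.face_castSucc_perm_swap,
        (isAlternating_of_mem hφ).perm_swap _ (Fin.castSucc_lt_succ).ne, inner_neg_left]
      ring
  refine ⟨s, ?_, ?_⟩
  · have h1 := HasOrbitSum.sum μ fun i => (hi i).const_mul μ ((-1) ^ (i : ℕ))
    have h2 : ∀ i : Fin (j + 2), (-1 : ℝ) ^ (i : ℕ) * ((-1) ^ (i : ℕ) * s) = s := fun i => by
      rw [← mul_assoc, ← mul_pow]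
      simp
    simp only [h2, Finset.sum_const, Finset.card_univ, Fintype.card_fin, nsmul_eq_mul] at h1
    push_cast at h1
    refine Eq.mp (congrArg (fun f => HasOrbitSum μ (R (j + 1)) f _) ?_) h1
    funext σ
    rw [diff_apply, inner_sum, Finset.mul_sum]
    refine Finset.sum_congr rfl fun i _ => ?_
    rw [← Int.cast_smul_eq_zsmul ℝ, inner_smul_right]
    push_cast
    ring
  · refine Eq.mp (congrArg (fun f => HasOrbitSum μ (R j) f _) ?_)
      (hs.coface μ hX hΓ hR (hinv 0))
    funext τ
    rw [cofaceSum, sum_inner]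
    refine Finset.sum_congr rfl fun σ hσ => ?_
    rw [(mem_coface hX σ τ).1 hσ, real_inner_smul_left]

include hX hΓ hR in
/-- The differential is bounded. -/
theorem exists_hasOrbitSum_diff {j : ℕ} (hj : j ≤ n) {ψ : OrdSimplex X j → H}
    (hψ : ψ ∈ twistedCochains X ρ j) {N : ℝ}
    (hN : HasOrbitSum μ (R j) (fun σ => mult n σ * ‖ψ σ‖ ^ 2) N) :
    ∃ N', HasOrbitSum μ (R (j + 1)) (fun σ => mult n σ * ‖diff X ℝ H j ψ σ‖ ^ 2) N' ∧
      N' ≤ (j + 2) * ((j + 2) * ((n - j) * N)) := by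
  have h1 := (HasOrbitSum.sum μ fun i =>
    hN.face μ hX hΓ hR hj (norm_sq_invariant hψ) i).const_mul μ (j + 2 : ℝ)
  simp only [Finset.sum_const, Finset.card_univ, Fintype.card_fin, nsmul_eq_mul] at h1
  push_cast at h1
  have h2 : ∀ σ : OrdSimplex X (j + 1), mult n σ * ‖diff X ℝ H j ψ σ‖ ^ 2 ≤
      (j + 2) * ∑ i, mult n σ * ‖ψ (σ.face i)‖ ^ 2 := fun σ => by
    rw [← Finset.mul_sum, mul_left_comm]
    exact mul_le_mul_of_nonneg_left (norm_diff_sq_le ψ σ) (mult_nonneg σ)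
  obtain ⟨N', hN'⟩ := (OrbitSummable.of_abs_le μ (h1.summable μ) fun σ => by
    rw [abs_of_nonneg (mul_nonneg (mult_nonneg σ) (sq_nonneg _))]
    exact h2 σ).exists_hasOrbitSum μ
  refine ⟨N', hN', ?_⟩
  have := hN'.mono μ h1 fun σ _ => h2 σ
  linarith

include hX hX_pure hX_links hΓ hR in
/-- Under the determinant condition every square integrable cocycle is the differential of a
square integrable cochain. -/
theorem exists_primitive {j l : ℕ} (hkl : j + 1 < l) (hl : l ≤ n) {ε : ℝ} (hε : 0 < ε)
    (h : ∀ γ ∈ R l, ∀ x : ℝ, MvPolynomial.eval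
      (fun f : Fin (j + 1 + 1) ↪o Fin (l + 1) => x - faceSum X n (γ.sub f))
      (detPoly (j + 1) l) = 0 → ε ≤ x)
    {φ : OrdSimplex X (j + 1) → H} (hφ : φ ∈ twistedCochains X ρ (j + 1))
    (hφ2 : OrbitSummable μ (R (j + 1)) fun σ => mult n σ * ‖φ σ‖ ^ 2)
    (hd : diff X ℝ H (j + 1) φ = 0) :
    ∃ ψ ∈ twistedCochains X ρ j, OrbitSummable μ (R j) (fun σ => mult n σ * ‖ψ σ‖ ^ 2) ∧
      diff X ℝ H j ψ = φ := by
  have hj : j + 1 < n := by omega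
  let P : Submodule ℝ (OrdSimplex X j → H) := (twistedCochains X ρ j).restrictScalars ℝ
  let Z : Submodule ℝ (OrdSimplex X (j + 1) → H) :=
    (twistedCochains X ρ (j + 1)).restrictScalars ℝ ⊓ LinearMap.ker (diff X ℝ H (j + 1))
  let E := l2Image n μ (R j) P
  let F := l2Image n μ (R (j + 1)) Z
  have hE : IsClosed (E : Set (lp (fun _ : R j => H) 2)) :=
    isClosed_l2Image μ hX_pure hΓ (hR j) (isClosed_twistedCochains j) fun φ hφ => hφ
  have hF : IsClosed (F : Set (lp (fun _ : R (j + 1) => H) 2)) :=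
    isClosed_l2Image μ hX_pure hΓ (hR (j + 1))
      ((isClosed_twistedCochains (j + 1)).inter (isClosed_ker_diff (j + 1))) fun φ hφ => hφ.1
  have : CompleteSpace E := hE.completeSpace_coe
  have : CompleteSpace F := hF.completeSpace_coe
  -- The chosen cochain `c x` is the only one representing `x`, which makes `c` linear and `T₀` well
  -- defined.
  choose c hcP hc using fun x : E => x.2
  have hsum : ∀ x : E, HasOrbitSum μ (R j) (fun σ => mult n σ * ‖c x σ‖ ^ 2) (‖x‖ ^ 2) := fun x => by
    have := hasOrbitSum_inner μ (hc x) (hc x)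
    simp only [real_inner_self_eq_norm_sq] at this
    exact this
  have hbound := fun x : E => exists_hasOrbitSum_diff μ hΓ hX hR (by omega) (hcP x) (hsum x)
  choose N' hN' hN'le using hbound
  choose y hy using fun x : E => exists_lp μ ((hN' x).summable μ)
  have hyF : ∀ x, y x ∈ F := fun x =>
    ⟨diff X ℝ H j (c x), ⟨diff_mem (hcP x), diff_diff (c x)⟩, hy x⟩
  have hcuniq : ∀ (x : E) (ψ : OrdSimplex X j → H), ψ ∈ twistedCochains X ρ j →
      (∀ r : R j, x.1 r = rootWeight n μ r.1 • ψ r) → c x = ψ := fun x ψ hψ hx =>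
    eq_of_eq_on μ hX_pure hΓ (hR j) (hcP x) hψ fun r => by rw [← hx, ← hc]
  have hcadd : ∀ x x', c (x + x') = c x + c x' := fun x x' =>
    hcuniq _ _ (Submodule.add_mem _ (hcP x) (hcP x')) fun r => by simp [← hc]
  have hcsmul : ∀ (a : ℝ) x, c (a • x) = a • c x := fun a x =>
    hcuniq _ _ (P.smul_mem a (hcP x)) fun r => by
      simp only [Pi.smul_apply]
      rw [smul_comm, ← hc]
      rfl
  let T₀ : E →ₗ[ℝ] F :=
    { toFun := fun x => ⟨y x, hyF x⟩
      map_add' := fun x x' => Subtype.ext <| lp.ext <| funext fun r => by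
        simp [hy, hcadd]
      map_smul' := fun a x => Subtype.ext <| lp.ext <| funext fun r => by
        simp [hy, hcsmul, smul_comm a] }
  let C : ℝ := (j + 2) * ((j + 2) * (n - j))
  have hnj : (0 : ℝ) < n - j := by
    rw [sub_pos, Nat.cast_lt]
    omega
  have hC : 0 ≤ C := by positivity
  let T : E →L[ℝ] F := T₀.mkContinuous √C fun x => by
    have h1 := hasOrbitSum_inner μ (hy x) (hy x)
    simp only [real_inner_self_eq_norm_sq] at h1
    have h2 := (h1.unique μ (hN' x)).le.trans (hN'le x)
    have h3 : ‖y x‖ ^ 2 ≤ (√C * ‖x‖) ^ 2 := by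
      rw [mul_pow, Real.sq_sqrt hC]
      refine h2.trans (le_of_eq ?_)
      simp only [C]
      ring
    exact (abs_le_of_sq_le_sq' h3 (by positivity)).2
  have hTc : ∀ x r, (T x).1 r = rootWeight n μ r.1 • diff X ℝ H j (c x) r := fun x r => hy x r
  have hn0 : (0 : ℝ) < n := by
    rw [Nat.cast_pos]
    omega
  let D : ℝ := (j + 2) * (2 * n / (n - j))
  have hD : 0 < D := by positivity
  have hsurj : Function.Surjective T := by
    -- The adjoint sends the class of `φ` to that of `(j + 2) δφ`, and `le_codiff_of_detPoly` reads
    -- `ε ‖φ‖² ≤ D ‖δφ‖²`. The target consists of cocycles only, so the estimate is needed for these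
    -- alone.
    refine surjective_of_adjoint_bounded_below (E := E) (F := F) T (c := (j + 2) * √(ε / D)) (by positivity)
      fun z => ?_
    obtain ⟨φ, ⟨hφ, hφd⟩, hzφ⟩ := z.2
    have hz := hasOrbitSum_inner μ hzφ hzφ
    simp only [real_inner_self_eq_norm_sq] at hz
    obtain ⟨M, hM⟩ :=
      (exists_hasOrbitSum_cofaceSum μ hX hX_pure hΓ hR hφ hz (by omega)).exists_hasOrbitSum μ
    have hest := le_codiff_of_detPoly μ hX hX_pure hX_links hΓ hR hφ hz hφd hkl hl h hM
    have hδ : (fun τ => ‖cofaceSum n φ τ‖ ^ 2 / mult n τ) =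
        fun τ => mult n τ * ‖codiffVec n φ τ‖ ^ 2 := by
      funext τ
      have h0 := mult_pos hX_pure τ
      rw [codiffVec, norm_smul, mul_pow, norm_inv, Real.norm_of_nonneg h0.le]
      field_simp
    rw [hδ] at hM
    obtain ⟨e, he⟩ := exists_lp μ (hM.summable μ)
    have heE : e ∈ E := ⟨codiffVec n φ, codiffVec_mem hX hφ, he⟩
    have hen := hasOrbitSum_inner μ he he
    simp only [real_inner_self_eq_norm_sq] at hen
    have hMe := hM.unique μ hen
    refine ⟨(j + 2 : ℝ) • ⟨e, heE⟩, ?_, fun x => ?_⟩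
    · rw [norm_smul, Real.norm_of_nonneg (by positivity), mul_assoc]
      refine mul_le_mul_of_nonneg_left ?_ (by positivity)
      change √(ε / D) * ‖z.1‖ ≤ ‖e‖
      refine (abs_le_of_sq_le_sq' ?_ (norm_nonneg _)).2
      rw [mul_pow, Real.sq_sqrt (by positivity), ← hMe, div_mul_eq_mul_div, div_le_iff₀ hD]
      linarith
    · obtain ⟨s, hs1, hs2⟩ := hasOrbitSum_inner_diff μ hΓ hX hR (by omega) hφ (hz.summable μ)
        (hcP x) ((hsum x).summable μ)
      have h1 := hasOrbitSum_inner μ hzφ (hTc x)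
      have h2 := hasOrbitSum_inner μ he (hc x)
      have h3 : (fun τ => mult n τ * inner ℝ (codiffVec n φ τ) (c x τ)) =
          fun τ => inner ℝ (cofaceSum n φ τ) (c x τ) := by
        funext τ
        rw [codiffVec, real_inner_smul_left, mul_inv_cancel_left₀ (mult_pos hX_pure τ).ne']
      rw [h3] at h2
      change inner ℝ ((j + 2 : ℝ) • e) x.1 = inner ℝ z.1 (T x).1
      rw [real_inner_smul_left, h2.unique μ hs2, h1.unique μ hs1]
  obtain ⟨z, hz⟩ := exists_lp μ hφ2
  obtain ⟨x, hx⟩ := hsurj ⟨z, φ, ⟨hφ, hd⟩, hz⟩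
  refine ⟨c x, hcP x, (hsum x).summable μ, ?_⟩
  refine eq_of_eq_on μ hX_pure hΓ (hR (j + 1)) (diff_mem (hcP x)) hφ fun r => ?_
  rw [← hTc, hx, ← hz]

omit [TopologicalSpace Γ] [IsTopologicalGroup Γ] [BorelSpace Γ] [μ.IsHaarMeasure]
  [μ.IsMulRightInvariant] in
-- The two weights differ by the constant factor `1 / (k+1)!`.
theorem summable_weight_iff {k : ℕ} (S : Set (OrdSimplex X k)) (φ : OrdSimplex X k → H) :
    (Summable fun σ : S => weight X μ n σ.1 * ‖φ σ.1‖ ^ 2) ↔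
      OrbitSummable μ S fun σ => mult n σ * ‖φ σ‖ ^ 2 := by
  have h1 : ((Nat.factorial (k + 1) : ℝ))⁻¹ ≠ 0 := by positivity
  unfold OrbitSummable
  rw [← summable_mul_left_iff (f := fun r : S => mult n r.1 * ‖φ r.1‖ ^ 2 / stabVol μ r.1) h1]
  refine summable_congr fun σ => ?_
  simp only [weight, stabVol, mult]
  ring

end Hilbert

end LinkCriterion

theorem theorem3p4
    {V : Type*} [DecidableEq V] (X : PreAbstractSimplicialComplex V) (n : ℕ)
    (hX_dim : LinkCriterion.HasDim X n)
    (hX_fin : LinkCriterion.IsLocallyFinite X)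
    (hX_pure : ∀ s ∈ X.faces, 1 ≤ LinkCriterion.topCount X n s)
    (hX_links : LinkCriterion.HasConnectedLinks X n)
    {Γ : Type*} [Group Γ] [TopologicalSpace Γ] [IsTopologicalGroup Γ] [LocallyCompactSpace Γ]
    [MeasurableSpace Γ] [BorelSpace Γ]
    (μ : MeasureTheory.Measure Γ) [μ.IsHaarMeasure] [μ.IsMulRightInvariant]
    [MulAction Γ V] [LinkCriterion.IsSimplicialAction Γ X]
    (hΓ : LinkCriterion.IsProperAction Γ X)
    (R : ∀ j : ℕ, Set (LinkCriterion.OrdSimplex X j))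
    (hR : ∀ j : ℕ, LinkCriterion.IsOrbitTransversal Γ (R j))
    (k : ℕ) (hk : 1 ≤ k)
    (h : ∃ l : ℕ, k < l ∧ l ≤ n ∧ ∃ ε : ℝ, 0 < ε ∧
      ∀ γ ∈ R l, ∀ x : ℝ,
        MvPolynomial.eval
          (fun f : Fin (k + 1) ↪o Fin (l + 1) => x - LinkCriterion.faceSum X n (γ.sub f))
          (LinkCriterion.detPoly k l) = 0 → ε ≤ x)
    {H : Type*} [NormedAddCommGroup H] [InnerProductSpace ℂ H] [CompleteSpace H]
    (ρ : Γ →* unitary (H →L[ℂ] H)) :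
    Subsingleton (LinkCriterion.L2Cohomology X ρ μ n R k) := by
  obtain ⟨j, rfl⟩ : ∃ j, k = j + 1 := ⟨k - 1, by omega⟩
  obtain ⟨l, hkl, hl, ε, hε, hdet⟩ := h
  -- The quotient is trivial exactly when every cocycle is a coboundary. The differentials over `ℝ`
  -- and over `ℂ` are the same function, so a primitive found with the real inner product suffices.
  refine Submodule.Quotient.subsingleton_iff.2 (Submodule.comap_subtype_eq_top.2 ?_)
  rintro φ ⟨⟨hφ, hφ2⟩, hd⟩
  obtain ⟨ψ, hψ, hψ2, rfl⟩ := LinkCriterion.exists_primitive μ hX_pure hΓ hX_fin hX_links hR hkl hl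
    hε hdet hφ ((LinkCriterion.summable_weight_iff μ _ _).1 hφ2) hd
  exact ⟨ψ, ⟨hψ, (LinkCriterion.summable_weight_iff μ _ _).2 hψ2⟩, rfl⟩
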